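/- Let $n\ge 1$ and let $p$ be a probability density on $\mathbb R^n$ with $p>0$ almost everywhere. For $\theta=(\mu,\sigma)\in\Theta:=\mathbb R^n\times\mathbb R^n$ let $q(\cdot;\theta)$ be the density of the Gaussian $\mathcal N(\mu,\operatorname{diag}(e^{2\sigma_1},\dots,e^{2\sigma_n}))$, and assume that $\mathbb E_{q(\cdot;\theta)}|\log p|<\infty$ for every $\theta$ (equivalently, that $\mathrm{KL}(q(\cdot;\theta)\|p)<\infty$). Let $p^*=\mathcal Z p$ with $\mathcal Z>0$, let $\mathcal F(\theta)_{ij}=-\mathbb E_{q(\cdot;\theta)}[\partial_{\theta_i}\partial_{\theta_j}\log q(x;\theta)]$ be the Fisher information matrix, $\mathrm{KL}(q\|p^*)=\int q\log (q/p^*)$, and for probability densities $\psi$ on $\Theta$ (for which both terms are convergent integrals) put $$\mathcal L_{\mathcal F}(\psi,\lambda)=-\int_\Theta\psi\log\psi\,d\theta+\int_\Theta\psi(\theta)\Big(\tfrac12\log|\mathcal F(\theta)|-\lambda\,\mathrm{KL}(q(\cdot;\theta)\|p^*)\Big)d\theta .$$ Take $\lambda=1$ and put $w(\theta)=\exp\big(\mathbb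 E_{q(\cdot;\theta)}[\log p]\big)$. Then: 1. For all $\theta$, $\ \tfrac12\log|\mathcal F(\theta)|-\mathrm{KL}(q(\cdot;\theta)\|p^*)=\mathbb E_{q(\cdot;\theta)}[\log p]+\tfrac n2\log(4\pi e)+\log\mathcal Z$. That is, up to an additive constant, the closed-form optimum of $\mathcal L_{\mathcal F}(\cdot,1)$ is $\log\psi(\theta)=\log w(\theta)=\mathbb E_{q(\cdot;\theta)}[\log p]$, the negative cross-entropy. 2. This $\psi=w$ is improper, $\int_\Theta w=\infty$, and it is the maximiser of $\mathcal L_{\mathcal F}(\cdot,1)$ in the following sense: for every bounded measurable $K\subset\Theta$ of positive volume, $\mathcal L_{\mathcal F}(\cdot,1)$ has, among the probability densities vanishing off $K$, an almost everywhere unique maximiser, namely $\mathbf 1_K\,w/\int_K w$. 3. As all $\sigma_i\to-\infty$, the conditional density $w(\cdot,\sigma)/\int w(\mu',\sigma)\,d\mu'$ of the mean given the scale converges to $p$ in $L^1(\mathbb R^n)$. 4. Let $K_k=\{(\mu,\sigma):|\mu_i|\le a_k,\ -s_k\le\sigma_i\le b_k\ \forall i\}$ with $a_k,s_k,b_k\to\infty$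 and $b_k=O(s_k)$, and let $\psi_k$ be a maximiser of $\mathcal L_{\mathcal F}(\cdot,1)$ among the probability densities vanishing off $K_k$. As $k\to\infty$: * (narrow) for every $\delta>0$, a draw $(\mu,\sigma)\sim\psi_k$ satisfies $e^{\sigma_i}\le\delta$ for all $i$ with probability tending to $1$; * (non-overlapping) for every $\varepsilon>0$ and independent $\theta,\theta'\sim\psi_k$, with probability tending to $1$ one has $q(x;\theta')<\varepsilon$ at every $x$ with $q(x;\theta)>\varepsilon$; * (means) the marginal density of $\mu$ under $\psi_k$ converges to $p$ in $L^1(\mathbb R^n)$; * (unbiased) the infinite mixture $m_k(x)=\int_\Theta q(x;\theta)\psi_k(\theta)\,d\theta$ converges to $p$ in $L^1(\mathbb R^n)$. Moreover, for each $k$, if $\theta^{(1)},\theta^{(2)},\dots$ are i.i.d. with density $\psi_k$, then for every $x$, almost surely $\frac1T\sum_{t=1}^Tq(x;\theta^{(t)})\to m_k(x)$ as $T\to\infty$. So the mixture is "sampling" at $\lambda=1$. -/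

import Mathlib

open MeasureTheory ProbabilityTheory Filter Topology Asymptotics

noncomputable section

/-- Parameters `θ = (μ, σ)` of a Gaussian on `ℝⁿ` with diagonal covariance: the mean `μ` and the
vector `σ` of log standard deviations. -/
abbrev Param (n : ℕ) : Type := (Fin n → ℝ) × (Fin n → ℝ)

/-- The component density `q(x; μ, σ)`: the product of the densities `N(μ i, exp (2 σ i))`. -/
def component {n : ℕ} (θ : Param n) (x : Fin n → ℝ) : ℝ :=
  ∏ i, gaussianPDFReal (θ.1 i) (Real.exp (2 * θ.2 i)).toNNReal (x i)

/-- The expectation `E_q[f]` under the component with parameter `θ`. -/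
def expect {n : ℕ} (θ : Param n) (f : (Fin n → ℝ) → ℝ) : ℝ :=
  ∫ x, component θ x * f x

/-- The coordinate directions of parameter space, first the means, then the log-scales. -/
def paramDir {n : ℕ} : Fin n ⊕ Fin n → Param n :=
  Sum.elim (fun i => (Pi.single i 1, 0)) (fun i => (0, Pi.single i 1))

/-- The Fisher information matrix `F(θ)ᵢⱼ = - E_q[∂²/∂θᵢ∂θⱼ log q(x; θ)]`. -/
def fisherInfo {n : ℕ} (θ : Param n) : Matrix (Fin n ⊕ Fin n) (Fin n ⊕ Fin n) ℝ :=
  fun i j => - expect θ (fun x =>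
    lineDeriv ℝ (fun θ' : Param n =>
      lineDeriv ℝ (fun θ'' : Param n => Real.log (component θ'' x)) θ' (paramDir j))
      θ (paramDir i))

/-- `KL(q(·; θ) ‖ r) = E_q[log (q / r)]` for a (possibly unnormalised) density `r`. -/
def compKL {n : ℕ} (r : (Fin n → ℝ) → ℝ) (θ : Param n) : ℝ :=
  expect θ (fun x => Real.log (component θ x / r x))

/-- `½ log |F(θ)| - lam * KL(q(·; θ) ‖ r)`. -/
def potential {n : ℕ} (r : (Fin n → ℝ) → ℝ) (lam : ℝ) (θ : Param n) : ℝ :=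
  1 / 2 * Real.log (fisherInfo θ).det - lam * compKL r θ

/-- The differential entropy of a density on parameter space. -/
def mixEntropy {n : ℕ} (ψ : Param n → ℝ) : ℝ :=
  - ∫ θ, ψ θ * Real.log (ψ θ)

/-- The approximate objective
`L_F(ψ, lam) = H[θ] + E_ψ[½ log |F(θ)| - lam * KL(q(·; θ) ‖ r)]`. -/
def objective {n : ℕ} (r : (Fin n → ℝ) → ℝ) (ψ : Param n → ℝ) (lam : ℝ) : ℝ :=
  mixEntropy ψ + ∫ θ, ψ θ * potential r lam θ

/-- `ψ` is a probability density on parameter space which vanishes outside `K` and for which both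
terms of the objective are convergent integrals. -/
structure IsMixingDensityOn {n : ℕ} (r : (Fin n → ℝ) → ℝ) (lam : ℝ) (K : Set (Param n))
    (ψ : Param n → ℝ) : Prop where
  measurable : Measurable ψ
  nonneg : ∀ θ, 0 ≤ ψ θ
  zero_off : ∀ θ, θ ∉ K → ψ θ = 0
  integrable : Integrable ψ
  integral_eq_one : ∫ θ, ψ θ = 1
  integrable_entropy : Integrable (fun θ => ψ θ * Real.log (ψ θ))
  integrable_potential : Integrable (fun θ => ψ θ * potential r lam θ)

/-- `ψ` maximises the objective among the mixing densities on `K`. -/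
def IsOptimalOn {n : ℕ} (r : (Fin n → ℝ) → ℝ) (lam : ℝ) (K : Set (Param n))
    (ψ : Param n → ℝ) : Prop :=
  IsMixingDensityOn r lam K ψ ∧
    ∀ φ, IsMixingDensityOn r lam K φ → objective r φ lam ≤ objective r ψ lam

/-- The improper density `ψ(θ) = exp (E_q[log p])`. -/
def negCEWeight {n : ℕ} (p : (Fin n → ℝ) → ℝ) (θ : Param n) : ℝ :=
  Real.exp (expect θ (fun x => Real.log (p x)))

/-- The improper density `exp (E_q[log p])`, restricted to `K` and normalised there. -/
def restrictedWeight {n : ℕ} (p : (Fin n → ℝ) → ℝ) (K : Set (Param n)) : Param n → ℝ :=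
  K.indicator (fun θ => negCEWeight p θ / ∫ θ' in K, negCEWeight p θ')

/-- The box of parameters with all means in `[-a, a]` and all log-scales in `[-s, b]`. -/
def paramBox (n : ℕ) (a s b : ℝ) : Set (Param n) :=
  {θ | ∀ i, |θ.1 i| ≤ a ∧ -s ≤ θ.2 i ∧ θ.2 i ≤ b}

/-- The distribution on parameter space with density `ψ`. -/
def mixingLaw {n : ℕ} (ψ : Param n → ℝ) : Measure (Param n) :=
  volume.withDensity (fun θ => ENNReal.ofReal (ψ θ))

/-- The infinite mixture `m(x) = ∫ q(x; θ) ψ(θ) dθ`. -/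
def mixture {n : ℕ} (ψ : Param n → ℝ) (x : Fin n → ℝ) : ℝ :=
  ∫ θ, component θ x * ψ θ

/-- The mixture `m_T(x)` of the first `T` components of a sequence of parameters. -/
def finiteMixture {n : ℕ} (ϑ : ℕ → Param n) (T : ℕ) (x : Fin n → ℝ) : ℝ :=
  1 / (T : ℝ) * ∑ t ∈ Finset.range T, component (ϑ t) x

/-- The infinite mixtures of the `ψ k` are unbiased for `p` in the limit: `m_k → p` in `L¹`. -/
def LimitUnbiased {n : ℕ} (p : (Fin n → ℝ) → ℝ) (ψ : ℕ → Param n → ℝ) : Prop :=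
  Tendsto (fun k => ∫⁻ x, ‖mixture (ψ k) x - p x‖ₑ) atTop (𝓝 0)

/-- The components drawn from the `ψ k` are non-overlapping in the limit: for every threshold `ε`,
two independent draws satisfy, with probability tending to one, `q(x; θ') < ε` at every `x` with
`q(x; θ) > ε`. -/
def LimitNonOverlapping {n : ℕ} (ψ : ℕ → Param n → ℝ) : Prop :=
  ∀ ε : ℝ, 0 < ε →
    Tendsto (fun k => ((mixingLaw (ψ k)).prod (mixingLaw (ψ k)))
      {w | ¬ ∀ x, ε < component w.1 x → component w.2 x < ε}) atTop (𝓝 0)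

/-- The components drawn from the `ψ k` become arbitrarily narrow: for every `δ > 0`, all standard
deviations of a draw are at most `δ`, with probability tending to one. -/
def LimitNarrow {n : ℕ} (ψ : ℕ → Param n → ℝ) : Prop :=
  ∀ δ : ℝ, 0 < δ →
    Tendsto (fun k => mixingLaw (ψ k) {θ | ¬ ∀ i, Real.exp (θ.2 i) ≤ δ}) atTop (𝓝 0)

/-- The marginal densities of the component means under the `ψ k` tend to `p` in `L¹`. -/
def LimitMeansDistributedAs {n : ℕ} (p : (Fin n → ℝ) → ℝ) (ψ : ℕ → Param n → ℝ) : Prop :=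
  Tendsto (fun k => ∫⁻ μ, ‖(∫ σ, ψ k (μ, σ)) - p μ‖ₑ) atTop (𝓝 0)

end

noncomputable section

/-! ### Gaussian components -/

/-! The Fisher matrix is diagonal with entries `exp (-2σᵢ)` and `2`, so half its log-determinant
contains `-∑ σᵢ`, while the entropy of a component contains `+∑ σᵢ`. At `λ = 1` these cancel and the
potential is `E_q[log p]` plus a constant (`potential_eq`). On a bounded region the objective is
then a constant minus the relative entropy with respect to the normalised weight `w`, whence
existence and uniqueness (`isOptimalOn_restrictedWeight`). Everything else concerns `w`.

Write `D(σ) = ∫ (p - w(·,σ))⁺` (`deficit`). Three facts about the fibres of `w` over a scale `σ`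
carry the proof. (a) Jensen gives `w ≤ q * p` (Gaussian smoothing of `p`), so each fibre has mass at
most `1`. (b) As `σ → -∞`, `E_q[log p] → log p` in `L¹` on cubes, since Gaussians form an
approximate identity; hence `D(σ) → 0` (`tendsto_deficit`). For densities of equal mass a one-sided
deficit controls the `L¹` distance (`lintegral_enorm_sub_le`), so lower bounds on densities suffice
throughout. (c) Jensen applied to `√p` gives `w ≤ (q * √p)²`, so the fibre mass is small as soon as
one scale is large, uniformly in the others (`exists_lintegral_weightENN_le`).

By (b) the fibre masses stay above `1/2` on an orthant of infinite volume, so `w` is improper. In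
the box `K_k` the normaliser is at least of order `s_k ^ n`, whereas by (a) and (c) the part with
some `σᵢ > L_k` has mass at most about `(S - L_k) s_k ^ (n-1) + ε s_k ^ n`, using `b_k = O(s_k)`.
Hence scales concentrate below any `L_k = o(s_k)` (`tendsto_mixingLaw_wide`).

With `ρ` the law of the scales, `ψ_k(μ,σ) ≥ ρ(σ) w(μ,σ)` on the box, so the deficits of the mean
marginal and of the mixture are bounded by `ρ`-averages of `D` plus the tail of `p` outside the cube
of means. For the mixture one also uses `w ≤ q * p` and the symmetry of `q` in point and mean. For
non-overlap take `L_k = -√s_k`: a common point of two superlevel sets forces the means within a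
distance of order `exp (-√s_k) √s_k`, and independent means, nearly distributed as `p`, are rarely
that close. -/

lemma toNNReal_exp_ne_zero (s : ℝ) : (Real.exp s).toNNReal ≠ 0 := by
  simp [Real.exp_pos]

lemma gaussianPDFReal_exp (m s x : ℝ) :
    gaussianPDFReal m (Real.exp (2 * s)).toNNReal x =
      (√(2 * Real.pi))⁻¹ * Real.exp (-s) * Real.exp (-((x - m) ^ 2 * Real.exp (-(2 * s)) / 2)) := by
  have h1 : √(Real.exp (2 * s)) = Real.exp s := by
    rw [show 2 * s = s + s by ring, Real.exp_add, Real.sqrt_mul_self (Real.exp_pos s).le]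
  rw [gaussianPDFReal, Real.coe_toNNReal _ (Real.exp_pos _).le, Real.sqrt_mul (by positivity), h1,
    mul_inv, Real.exp_neg s, Real.exp_neg (2 * s)]
  congr 2
  have := Real.exp_ne_zero (2 * s)
  field_simp

section Component

variable {n : ℕ}

lemma component_pos (θ : Param n) (x : Fin n → ℝ) : 0 < component θ x :=
  Finset.prod_pos fun _ _ => gaussianPDFReal_pos _ _ _ (toNNReal_exp_ne_zero _)

lemma measurable_component_uncurry :
    Measurable (fun z : Param n × (Fin n → ℝ) => component z.1 z.2) := by
  unfold component
  refine Finset.measurable_fun_prod _ fun i _ => ?_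
  simp only [gaussianPDFReal_exp]
  fun_prop

lemma measurable_component (θ : Param n) : Measurable (component θ) := by
  have h := (measurable_component_uncurry (n := n)).comp (measurable_prodMk_left (x := θ))
  simpa only [Function.comp_def] using h

lemma measurable_component_left (x : Fin n → ℝ) : Measurable fun θ : Param n => component θ x := by
  have h := (measurable_component_uncurry (n := n)).comp (measurable_prodMk_right (y := x))
  simpa only [Function.comp_def] using h

lemma integrable_component (θ : Param n) : Integrable (component θ) :=
  Integrable.fintype_prod fun _ => integrable_gaussianPDFReal _ _

lemma integral_component (θ : Param n) : ∫ x, component θ x = 1 := by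
  unfold component
  rw [integral_fintype_prod_volume_eq_prod
    (fun i y => gaussianPDFReal (θ.1 i) (Real.exp (2 * θ.2 i)).toNNReal y)]
  exact Finset.prod_eq_one fun i _ => integral_gaussianPDFReal_eq_one _ (toNNReal_exp_ne_zero _)

/-- The density depends on point and mean only through the square of their difference. This turns
integrals over the mean into integrals of a probability density. -/
lemma component_swap (μ σ x : Fin n → ℝ) : component (μ, σ) x = component (x, σ) μ := by
  unfold component
  refine Finset.prod_congr rfl fun i _ => ?_
  simp only [gaussianPDFReal_exp]
  congr 4
  ring

/-- The component density with values in `[0, ∞]`. -/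
def componentENN (θ : Param n) (x : Fin n → ℝ) : ENNReal := ENNReal.ofReal (component θ x)

lemma measurable_componentENN (θ : Param n) : Measurable (componentENN θ) :=
  (measurable_component θ).ennreal_ofReal

lemma measurable_componentENN_left (x : Fin n → ℝ) :
    Measurable fun θ : Param n => componentENN θ x :=
  (measurable_component_left x).ennreal_ofReal

lemma lintegral_componentENN (θ : Param n) : ∫⁻ x, componentENN θ x = 1 := by
  unfold componentENN
  rw [← ofReal_integral_eq_lintegral_ofReal (integrable_component θ)
    (ae_of_all _ fun x => (component_pos θ x).le), integral_component, ENNReal.ofReal_one]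

lemma componentENN_swap (μ σ x : Fin n → ℝ) : componentENN (μ, σ) x = componentENN (x, σ) μ := by
  simp only [componentENN, component_swap μ σ x]

lemma lintegral_componentENN_mean (σ x : Fin n → ℝ) : ∫⁻ μ, componentENN (μ, σ) x = 1 := by
  simp_rw [componentENN_swap _ σ x]
  exact lintegral_componentENN _

/-! ### Moments of a single coordinate. -/

lemma component_mul_coord (θ : Param n) (i : Fin n) (h : ℝ → ℝ) (x : Fin n → ℝ) :
    component θ x * h (x i) =
      ∏ j, (gaussianPDFReal (θ.1 j) (Real.exp (2 * θ.2 j)).toNNReal (x j) *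
        if j = i then h (x j) else 1) := by
  rw [Finset.prod_mul_distrib]
  simp [component]

lemma integral_component_mul_coord (θ : Param n) (i : Fin n) (h : ℝ → ℝ) :
    ∫ x, component θ x * h (x i) =
      ∫ y, gaussianPDFReal (θ.1 i) (Real.exp (2 * θ.2 i)).toNNReal y * h y := by
  simp_rw [component_mul_coord θ i h]
  rw [integral_fintype_prod_volume_eq_prod (fun j y =>
    gaussianPDFReal (θ.1 j) (Real.exp (2 * θ.2 j)).toNNReal y * if j = i then h y else 1)]
  rw [Finset.prod_eq_single i]
  · simp
  · intro j _ hj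
    simp [hj, integral_gaussianPDFReal_eq_one _ (toNNReal_exp_ne_zero _)]
  · simp

lemma integrable_component_mul_coord (θ : Param n) (i : Fin n) (h : ℝ → ℝ)
    (hh : Integrable fun y =>
      gaussianPDFReal (θ.1 i) (Real.exp (2 * θ.2 i)).toNNReal y * h y) :
    Integrable fun x => component θ x * h (x i) := by
  simp_rw [component_mul_coord θ i h]
  refine Integrable.fintype_prod (f := fun j y =>
    gaussianPDFReal (θ.1 j) (Real.exp (2 * θ.2 j)).toNNReal y * if j = i then h y else 1) ?_
  intro j
  by_cases hj : j = i
  · subst hj; simpa using hh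
  · simpa [hj] using integrable_gaussianPDFReal _ _

lemma integrable_gaussianPDFReal_mul {m : ℝ} {v : NNReal} (hv : v ≠ 0) {f : ℝ → ℝ}
    (hf : Integrable f (gaussianReal m v)) : Integrable fun y => gaussianPDFReal m v y * f y := by
  rw [gaussianReal_of_var_ne_zero _ hv, integrable_withDensity_iff_integrable_smul'
    (measurable_gaussianPDF _ _) (ae_of_all _ fun _ => gaussianPDF_lt_top)] at hf
  simpa [toReal_gaussianPDF] using hf

lemma integral_gaussianPDFReal_mul {m : ℝ} {v : NNReal} (hv : v ≠ 0) (f : ℝ → ℝ) :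
    ∫ y, gaussianPDFReal m v y * f y = ∫ y, f y ∂gaussianReal m v := by
  simpa using (integral_gaussianReal_eq_integral_smul (μ := m) hv (f := f)).symm

lemma integrable_component_mul_sub (θ : Param n) (i : Fin n) :
    Integrable fun x => component θ x * (x i - θ.1 i) := by
  refine integrable_component_mul_coord θ i (fun y => y - θ.1 i)
    (integrable_gaussianPDFReal_mul (toNNReal_exp_ne_zero _) ?_)
  exact ((memLp_id_gaussianReal 1).integrable (by simp)).sub (integrable_const _)

lemma expect_sub (θ : Param n) (i : Fin n) : expect θ (fun x => x i - θ.1 i) = 0 := by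
  unfold expect
  rw [integral_component_mul_coord θ i (fun y => y - θ.1 i),
    integral_gaussianPDFReal_mul (toNNReal_exp_ne_zero _), integral_sub, integral_id_gaussianReal]
  · simp
  · exact (memLp_id_gaussianReal 1).integrable (by simp)
  · exact integrable_const _

lemma integrable_component_mul_sub_sq (θ : Param n) (i : Fin n) :
    Integrable fun x => component θ x * (x i - θ.1 i) ^ 2 := by
  refine integrable_component_mul_coord θ i (fun y => (y - θ.1 i) ^ 2)
    (integrable_gaussianPDFReal_mul (toNNReal_exp_ne_zero _) ?_)
  exact ((memLp_id_gaussianReal 2).sub (memLp_const _)).integrable_sq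

lemma expect_sub_sq (θ : Param n) (i : Fin n) :
    expect θ (fun x => (x i - θ.1 i) ^ 2) = Real.exp (2 * θ.2 i) := by
  unfold expect
  rw [integral_component_mul_coord θ i (fun y => (y - θ.1 i) ^ 2),
    integral_gaussianPDFReal_mul (toNNReal_exp_ne_zero _)]
  have h := variance_fun_id_gaussianReal (μ := θ.1 i) (v := (Real.exp (2 * θ.2 i)).toNNReal)
  rw [variance_eq_integral aemeasurable_id', integral_id_gaussianReal,
    Real.coe_toNNReal _ (Real.exp_pos _).le] at h
  exact h

/-! ### Pointwise domination of components. -/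

lemma gaussianPDFReal_le_exp_neg (m s x : ℝ) :
    gaussianPDFReal m (Real.exp (2 * s)).toNNReal x ≤ Real.exp (-s) := by
  rw [gaussianPDFReal_exp]
  have h1 : (√(2 * Real.pi))⁻¹ ≤ 1 := by
    apply inv_le_one_of_one_le₀
    rw [Real.one_le_sqrt]
    linarith [Real.pi_gt_three]
  have h2 : Real.exp (-((x - m) ^ 2 * Real.exp (-(2 * s)) / 2)) ≤ 1 :=
    Real.exp_le_one_iff.2 (neg_nonpos.2 (by positivity))
  calc _ ≤ 1 * Real.exp (-s) * 1 := by gcongr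
    _ = _ := by ring

lemma component_le_exp_neg (θ : Param n) (x : Fin n → ℝ) :
    component θ x ≤ ∏ i, Real.exp (-θ.2 i) :=
  Finset.prod_le_prod (fun _ _ => gaussianPDFReal_nonneg _ _ _)
    fun _ _ => gaussianPDFReal_le_exp_neg _ _ _

/-- A Gaussian density with mean in `[-R, R]` and log-scale at most `b` is dominated by a fixed
Gaussian density, with an integrable Gaussian factor in the mean to spare. -/
lemma gaussianPDFReal_le_mul (R b : ℝ) : ∃ C : ℝ, 0 < C ∧ ∀ m s x : ℝ, |m| ≤ R → s ≤ b →
    gaussianPDFReal m (Real.exp (2 * s)).toNNReal x ≤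
      C * (gaussianPDFReal 0 (Real.exp (2 * (b + Real.log 2))).toNNReal x *
        gaussianPDFReal m (Real.exp (2 * (s + Real.log 2))).toNNReal x) := by
  have hsq : 0 < √(2 * Real.pi) := Real.sqrt_pos.2 (by positivity)
  -- The first three factors undo the normalising constant of the fixed Gaussian and the halving in
  -- that of the widened one; the last pays for the displacement of the mean.
  refine ⟨2 * √(2 * Real.pi) * Real.exp (b + Real.log 2) * Real.exp (R ^ 2 * Real.exp (-(2 * b))),
    by positivity, fun m s x hm hs => ?_⟩
  simp only [gaussianPDFReal_exp]
  have e1 : Real.exp (-(2 * (b + Real.log 2))) = Real.exp (-(2 * b)) / 4 := by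
    rw [show -(2 * (b + Real.log 2)) = -(2*b) + (-Real.log 2 + -Real.log 2) by ring,
      Real.exp_add, Real.exp_add, Real.exp_neg (Real.log 2), Real.exp_log two_pos]; ring
  have e2 : Real.exp (-(2 * (s + Real.log 2))) = Real.exp (-(2 * s)) / 4 := by
    rw [show -(2 * (s + Real.log 2)) = -(2*s) + (-Real.log 2 + -Real.log 2) by ring,
      Real.exp_add, Real.exp_add, Real.exp_neg (Real.log 2), Real.exp_log two_pos]; ring
  have e3 : Real.exp (-(s + Real.log 2)) = Real.exp (-s) / 2 := by
    rw [neg_add, Real.exp_add, Real.exp_neg (Real.log 2), Real.exp_log two_pos]; ring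
  rw [e1, e2, e3]
  -- Doubling both standard deviations quarters the exponents. By `x² ≤ 2m² + 2(x-m)²` and `exp
  -- (-2b) ≤ exp (-2s)`, the two new exponents use at most three eighths of `(x-m)² exp (-2s)`,
  -- where one half is available.
  have key : -((x - m) ^ 2 * Real.exp (-(2 * s)) / 2) ≤ R ^ 2 * Real.exp (-(2 * b)) +
      (-((x - 0) ^ 2 * (Real.exp (-(2 * b)) / 4) / 2)) +
      (-((x - m) ^ 2 * (Real.exp (-(2 * s)) / 4) / 2)) := by
    have hbs : Real.exp (-(2 * b)) ≤ Real.exp (-(2 * s)) := Real.exp_le_exp.2 (by linarith)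
    have hb := Real.exp_pos (-(2 * b))
    have hm2 : m ^ 2 ≤ R ^ 2 := sq_le_sq' (by linarith [(abs_le.1 hm).1]) (abs_le.1 hm).2
    have h1 := mul_le_mul_of_nonneg_left hbs (sq_nonneg (x - m))
    have h2 := mul_le_mul_of_nonneg_right hm2 hb.le
    have h3 : x ^ 2 * Real.exp (-(2 * b)) ≤
        (2 * m ^ 2 + 2 * (x - m) ^ 2) * Real.exp (-(2 * b)) :=
      mul_le_mul_of_nonneg_right (by nlinarith [sq_nonneg (x - 2 * m)]) hb.le
    nlinarith [mul_nonneg (sq_nonneg (x - m)) hb.le]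
  have key2 := Real.exp_le_exp.2 key
  rw [Real.exp_add, Real.exp_add] at key2
  set A := Real.exp (-((x - 0) ^ 2 * (Real.exp (-(2 * b)) / 4) / 2))
  set B := Real.exp (-((x - m) ^ 2 * (Real.exp (-(2 * s)) / 4) / 2))
  set D := Real.exp (R ^ 2 * Real.exp (-(2 * b)))
  have e4 : Real.exp (b + Real.log 2) * Real.exp (-(b + Real.log 2)) = 1 := by
    rw [← Real.exp_add]; simp
  have e5 : √(2 * Real.pi) * (√(2 * Real.pi))⁻¹ = 1 := mul_inv_cancel₀ hsq.ne'
  set G := Real.exp (-(b + Real.log 2))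
  set H := Real.exp (b + Real.log 2)
  have hs' := Real.exp_pos (-s)
  calc _ ≤ (√(2 * Real.pi))⁻¹ * Real.exp (-s) * (D * A * B) :=
        mul_le_mul_of_nonneg_left key2 (by positivity)
    _ = (√(2 * Real.pi))⁻¹ * Real.exp (-s) * (H * G) *
          (√(2 * Real.pi) * (√(2 * Real.pi))⁻¹) * (D * A * B) := by
        rw [e4, e5, mul_one, mul_one]
    _ = _ := by ring

/-- The log-scales `σ + log 2`. -/
def widen (σ : Fin n → ℝ) : Fin n → ℝ := fun i => σ i + Real.log 2

/-- The first factor does not depend on `θ`, and the second has integral one over the mean; this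
yields bounds uniform in arbitrarily negative log-scales. -/
lemma component_le_mul (R b : ℝ) : ∃ C : ℝ, 0 < C ∧ ∀ (θ : Param n) (x : Fin n → ℝ),
    (∀ i, |θ.1 i| ≤ R) → (∀ i, θ.2 i ≤ b) →
    component θ x ≤ C * (component (0, widen fun _ => b) x * component (θ.1, widen θ.2) x) := by
  obtain ⟨C, hC, h⟩ := gaussianPDFReal_le_mul R b
  refine ⟨C ^ n, by positivity, fun θ x h1 h2 => ?_⟩
  unfold component
  rw [← Finset.prod_mul_distrib]
  have : C ^ n = ∏ _i : Fin n, C := by simp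
  rw [this, ← Finset.prod_mul_distrib]
  exact Finset.prod_le_prod (fun i _ => gaussianPDFReal_nonneg _ _ _)
    fun i _ => h _ _ _ (h1 i) (h2 i)

lemma component_le_of_bounds (R s b : ℝ) : ∃ C : ℝ, 0 < C ∧ ∀ (θ : Param n) (x : Fin n → ℝ),
    (∀ i, |θ.1 i| ≤ R) → (∀ i, -s ≤ θ.2 i ∧ θ.2 i ≤ b) →
    component θ x ≤ C * component (0, widen fun _ => b) x := by
  obtain ⟨C, hC, h⟩ := component_le_mul (n := n) R b
  refine ⟨C * Real.exp s ^ n, by positivity, fun θ x h1 h2 => (h θ x h1 fun i => (h2 i).2).trans ?_⟩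
  have : component (θ.1, widen θ.2) x ≤ Real.exp s ^ n := by
    refine (component_le_exp_neg _ _).trans ?_
    rw [show Real.exp s ^ n = ∏ _i : Fin n, Real.exp s by simp]
    refine Finset.prod_le_prod (fun i _ => (Real.exp_pos _).le) fun i _ => Real.exp_le_exp.2 ?_
    have := (h2 i).1
    have := Real.log_nonneg (one_le_two (α := ℝ))
    simp only [widen]
    linarith
  have h0 := (component_pos (0, widen fun _ => b) x).le
  calc _ ≤ C * (component (0, widen fun _ => b) x * Real.exp s ^ n) := by gcongr
    _ = _ := by ring

/-! ### The Fisher information and the closed-form optimum -/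

lemma log_component (θ : Param n) (x : Fin n → ℝ) :
    Real.log (component θ x) = ∑ i, (-(1 / 2 * Real.log (2 * Real.pi)) - θ.2 i -
      (x i - θ.1 i) ^ 2 * Real.exp (-(2 * θ.2 i)) / 2) := by
  unfold component
  rw [Real.log_prod fun i _ => (gaussianPDFReal_pos _ _ _ (toNNReal_exp_ne_zero _)).ne']
  refine Finset.sum_congr rfl fun i _ => ?_
  have hsq : √(2 * Real.pi) ≠ 0 := (Real.sqrt_pos.2 (by positivity)).ne'
  rw [gaussianPDFReal_exp, Real.log_mul (by positivity) (Real.exp_ne_zero _), Real.log_exp,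
    Real.log_mul (inv_ne_zero hsq) (Real.exp_ne_zero _), Real.log_exp, Real.log_inv,
    Real.log_sqrt (by positivity)]
  ring

end Component

section Fisher
variable {n : ℕ}

lemma lineDeriv_log_component (x : Fin n → ℝ) (θ v : Param n) :
    lineDeriv ℝ (fun θ' : Param n => Real.log (component θ' x)) θ v =
      ∑ i, (-v.2 i + (x i - θ.1 i) * v.1 i * Real.exp (-(2 * θ.2 i)) +
        (x i - θ.1 i) ^ 2 * v.2 i * Real.exp (-(2 * θ.2 i))) := by
  unfold lineDeriv
  refine HasDerivAt.deriv ?_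
  simp only [log_component]
  refine HasDerivAt.fun_sum fun i _ => ?_
  have h1 : HasDerivAt (fun t : ℝ => θ.1 i + t * v.1 i) (v.1 i) 0 := by
    simpa using ((hasDerivAt_id (0 : ℝ)).mul_const (v.1 i)).const_add (θ.1 i)
  have h2 : HasDerivAt (fun t : ℝ => θ.2 i + t * v.2 i) (v.2 i) 0 := by
    simpa using ((hasDerivAt_id (0 : ℝ)).mul_const (v.2 i)).const_add (θ.2 i)
  have h3 := (h2.const_sub (-(1 / 2 * Real.log (2 * Real.pi)))).sub
    ((((h1.const_sub (x i)).pow 2).mul ((h2.const_mul 2).neg.exp)).div_const 2)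
  refine h3.congr_deriv ?_
  simp
  ring

lemma lineDeriv_lineDeriv_log_component (x : Fin n → ℝ) (θ v w : Param n) :
    lineDeriv ℝ (fun θ' : Param n =>
      lineDeriv ℝ (fun θ'' : Param n => Real.log (component θ'' x)) θ' v) θ w =
      ∑ i, (-(w.1 i * v.1 i * Real.exp (-(2 * θ.2 i))) +
        -(2 * (w.2 i * v.1 i + w.1 i * v.2 i) * Real.exp (-(2 * θ.2 i))) * (x i - θ.1 i) +
        -(2 * (w.2 i * v.2 i) * Real.exp (-(2 * θ.2 i))) * (x i - θ.1 i) ^ 2) := by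
  simp only [lineDeriv_log_component]
  unfold lineDeriv
  refine HasDerivAt.deriv ?_
  refine HasDerivAt.fun_sum fun i _ => ?_
  have h1 : HasDerivAt (fun t : ℝ => θ.1 i + t * w.1 i) (w.1 i) 0 := by
    simpa using ((hasDerivAt_id (0 : ℝ)).mul_const (w.1 i)).const_add (θ.1 i)
  have h2 : HasDerivAt (fun t : ℝ => θ.2 i + t * w.2 i) (w.2 i) 0 := by
    simpa using ((hasDerivAt_id (0 : ℝ)).mul_const (w.2 i)).const_add (θ.2 i)
  have he := (h2.const_mul 2).neg.exp
  have h3 := ((((h1.const_sub (x i)).mul_const (v.1 i)).mul he).const_add (-v.2 i)).add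
    ((((h1.const_sub (x i)).pow 2).mul_const (v.2 i)).mul he)
  refine h3.congr_deriv ?_
  simp
  ring

/-- Both the log-density and its second derivatives in the parameters have this form, so one
computation serves the Fisher information and the entropy. -/
lemma expect_quadratic (θ : Param n) (a b c : Fin n → ℝ) :
    expect θ (fun x => ∑ i, (a i + b i * (x i - θ.1 i) + c i * (x i - θ.1 i) ^ 2)) =
      ∑ i, (a i + c i * Real.exp (2 * θ.2 i)) ∧
    Integrable (fun x =>
      component θ x * ∑ i, (a i + b i * (x i - θ.1 i) + c i * (x i - θ.1 i) ^ 2)) := by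
  have e : ∀ x, component θ x * ∑ i, (a i + b i * (x i - θ.1 i) + c i * (x i - θ.1 i) ^ 2) =
      ∑ i, (a i * component θ x + b i * (component θ x * (x i - θ.1 i)) +
        c i * (component θ x * (x i - θ.1 i) ^ 2)) := fun x => by
    rw [Finset.mul_sum]
    exact Finset.sum_congr rfl fun i _ => by ring
  have i1 := fun i => (integrable_component θ).const_mul (a i)
  have i2 := fun i => (integrable_component_mul_sub θ i).const_mul (b i)
  have i3 := fun i => (integrable_component_mul_sub_sq θ i).const_mul (c i)
  refine ⟨?_, ?_⟩
  · unfold expect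
    simp_rw [e]
    have i123 : ∀ i, Integrable fun x => a i * component θ x +
        b i * (component θ x * (x i - θ.1 i)) + c i * (component θ x * (x i - θ.1 i) ^ 2) :=
      fun i => ((i1 i).add (i2 i)).add (i3 i)
    rw [integral_finsetSum _ fun i _ => i123 i]
    refine Finset.sum_congr rfl fun i _ => ?_
    have h1 := expect_sub θ i
    have h2 := expect_sub_sq θ i
    unfold expect at h1 h2
    have i12 : Integrable fun x => a i * component θ x + b i * (component θ x * (x i - θ.1 i)) :=
      (i1 i).add (i2 i)
    rw [integral_add i12 (i3 i), integral_add (i1 i) (i2 i), integral_const_mul,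
      integral_const_mul, integral_const_mul, integral_component, h1, h2]
    ring
  · simp_rw [e]
    exact integrable_finsetSum _ fun i _ => ((i1 i).add (i2 i)).add (i3 i)

lemma fisherInfo_eq_sum (θ : Param n) (i j : Fin n ⊕ Fin n) :
    fisherInfo θ i j = ∑ l, ((paramDir i).1 l * (paramDir j).1 l * Real.exp (-(2 * θ.2 l)) +
      2 * ((paramDir i).2 l * (paramDir j).2 l)) := by
  unfold fisherInfo
  simp only [lineDeriv_lineDeriv_log_component]
  rw [(expect_quadratic θ _ _ _).1, ← Finset.sum_neg_distrib]
  refine Finset.sum_congr rfl fun l _ => ?_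
  have : Real.exp (-(2 * θ.2 l)) * Real.exp (2 * θ.2 l) = 1 := by
    rw [← Real.exp_add]; simp
  linear_combination 2 * ((paramDir i).2 l * (paramDir j).2 l) * this

lemma fisherInfo_eq_diagonal (θ : Param n) :
    fisherInfo θ = Matrix.diagonal (Sum.elim (fun l => Real.exp (-(2 * θ.2 l))) fun _ => 2) := by
  ext i j
  rw [fisherInfo_eq_sum]
  rcases i with i | i <;> rcases j with j | j
  · rcases eq_or_ne i j with rfl | h
    · simp [paramDir, Pi.single_apply]
    · simp [paramDir, Pi.single_apply, h, h.symm]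
  all_goals simp [paramDir, Matrix.diagonal_apply, Pi.single_apply, eq_comm]

lemma half_log_det_fisherInfo (θ : Param n) :
    1 / 2 * Real.log (fisherInfo θ).det = (n : ℝ) / 2 * Real.log 2 - ∑ i, θ.2 i := by
  rw [fisherInfo_eq_diagonal, Matrix.det_diagonal, Fintype.prod_sum_type]
  simp only [Sum.elim_inl, Sum.elim_inr]
  rw [Real.log_mul (Finset.prod_ne_zero_iff.2 fun i _ => Real.exp_ne_zero _) (by simp),
    ← Real.exp_sum, Real.log_exp]
  simp only [Finset.prod_const, Finset.card_univ, Fintype.card_fin, Real.log_pow,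
    Finset.sum_neg_distrib, ← Finset.mul_sum]
  ring

lemma log_component_quadratic (θ : Param n) (x : Fin n → ℝ) :
    Real.log (component θ x) = ∑ i, ((-(1 / 2 * Real.log (2 * Real.pi)) - θ.2 i) +
      0 * (x i - θ.1 i) + (-(Real.exp (-(2 * θ.2 i)) / 2)) * (x i - θ.1 i) ^ 2) := by
  rw [log_component]
  exact Finset.sum_congr rfl fun i _ => by ring

lemma expect_log_component (θ : Param n) :
    expect θ (fun x => Real.log (component θ x)) =
      -((n : ℝ) / 2 * (Real.log (2 * Real.pi) + 1)) - ∑ i, θ.2 i := by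
  simp only [log_component_quadratic]
  rw [(expect_quadratic θ (fun i => -(1 / 2 * Real.log (2 * Real.pi)) - θ.2 i) (fun _ => 0)
    fun i => -(Real.exp (-(2 * θ.2 i)) / 2)).1]
  have : ∀ i, -(1 / 2 * Real.log (2 * Real.pi)) - θ.2 i +
      -(Real.exp (-(2 * θ.2 i)) / 2) * Real.exp (2 * θ.2 i) =
      (-(1 / 2 * (Real.log (2 * Real.pi) + 1))) - θ.2 i := fun i => by
    have : Real.exp (-(2 * θ.2 i)) * Real.exp (2 * θ.2 i) = 1 := by
      rw [← Real.exp_add]; simp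
    linear_combination -(1 / 2) * this
  simp_rw [this]
  rw [Finset.sum_sub_distrib]
  simp
  ring

lemma integrable_component_mul_log (θ : Param n) :
    Integrable fun x => component θ x * Real.log (component θ x) := by
  simp only [log_component_quadratic]
  exact (expect_quadratic θ (fun i => -(1 / 2 * Real.log (2 * Real.pi)) - θ.2 i) (fun _ => 0)
    fun i => -(Real.exp (-(2 * θ.2 i)) / 2)).2

/-- The `-∑ σ i` of the half log-determinant cancels the `+∑ σ i` of the entropy, and `n/2 * log 2 +
n/2 * (log (2π) + 1)` is the stated constant. -/
theorem potential_eq {p pstar : (Fin n → ℝ) → ℝ} (hp_pos : ∀ᵐ x, 0 < p x)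
    (hp_log : ∀ θ : Param n, Integrable (fun x => component θ x * Real.log (p x)))
    {Z : ℝ} (hZ : 0 < Z) (hpstar : ∀ x, pstar x = Z * p x) (θ : Param n) :
    potential pstar 1 θ = expect θ (fun x => Real.log (p x)) +
      ((n : ℝ) / 2 * Real.log (4 * Real.pi * Real.exp 1) + Real.log Z) := by
  have h1 : compKL pstar θ = expect θ (fun x => Real.log (component θ x)) -
      Real.log Z - expect θ (fun x => Real.log (p x)) := by
    have : compKL pstar θ = ∫ x, (component θ x * Real.log (component θ x) -
        Real.log Z * component θ x - component θ x * Real.log (p x)) := by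
      refine integral_congr_ae ?_
      filter_upwards [hp_pos] with x hx
      rw [hpstar, Real.log_div (component_pos _ _).ne' (by positivity),
        Real.log_mul hZ.ne' hx.ne']
      ring
    have i1 : Integrable fun x => component θ x * Real.log (component θ x) -
        Real.log Z * component θ x :=
      (integrable_component_mul_log θ).sub ((integrable_component θ).const_mul _)
    rw [this, integral_sub i1 (hp_log θ), integral_sub (integrable_component_mul_log θ)
      ((integrable_component θ).const_mul _), integral_const_mul, integral_component, mul_one]
    rfl
  have h4 : Real.log (4 * Real.pi) = Real.log 2 + Real.log (2 * Real.pi) := by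
    rw [← Real.log_mul two_ne_zero (by positivity)]
    ring_nf
  rw [potential, half_log_det_fisherInfo, h1, expect_log_component, Real.log_mul (by positivity)
    (Real.exp_ne_zero _), Real.log_exp, h4]
  ring

end Fisher

section Smoothing
variable {n : ℕ}

/-! ### Gaussian smoothing -/

@[fun_prop]
lemma Measurable.component {α : Type*} [MeasurableSpace α] {f : α → Param n}
    {g : α → Fin n → ℝ} (hf : Measurable f) (hg : Measurable g) :
    Measurable fun a => component (f a) (g a) := by
  have h := (measurable_component_uncurry (n := n)).comp (hf.prodMk hg)
  simpa only [Function.comp_def] using h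

@[fun_prop]
lemma Measurable.componentENN {α : Type*} [MeasurableSpace α] {f : α → Param n}
    {g : α → Fin n → ℝ} (hf : Measurable f) (hg : Measurable g) :
    Measurable fun a => componentENN (f a) (g a) :=
  (hf.component hg).ennreal_ofReal

/-- The cube `[-R, R]ⁿ`. -/
def cube (n : ℕ) (R : ℝ) : Set (Fin n → ℝ) := Set.Icc (fun _ => -R) (fun _ => R)

lemma mem_cube {R : ℝ} {x : Fin n → ℝ} : x ∈ cube n R ↔ ∀ i, |x i| ≤ R := by
  simp [cube, Set.mem_Icc, Pi.le_def, abs_le, forall_and]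

lemma measurableSet_cube (R : ℝ) : MeasurableSet (cube n R) := measurableSet_Icc

lemma isCompact_cube (R : ℝ) : IsCompact (cube n R) := isCompact_Icc

lemma volume_cube_ne_top (R : ℝ) : volume (cube n R) ≠ ⊤ := (isCompact_cube R).measure_lt_top.ne

lemma measurable_expect {f : (Fin n → ℝ) → ℝ} (hf : Measurable f) :
    Measurable fun θ : Param n => expect θ f := by
  have h : Measurable (Function.uncurry fun (θ : Param n) (x : Fin n → ℝ) =>
      component θ x * f x) :=
    (measurable_fst.component measurable_snd).mul (hf.comp measurable_snd)
  exact h.stronglyMeasurable.integral_prod_right.measurable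

lemma enorm_component_mul (θ : Param n) (f : (Fin n → ℝ) → ℝ) (x : Fin n → ℝ) :
    ‖component θ x * f x‖ₑ = componentENN θ x * ‖f x‖ₑ := by
  rw [enorm_mul, Real.enorm_of_nonneg (component_pos θ x).le, componentENN]

lemma enorm_expect_le (θ : Param n) (f : (Fin n → ℝ) → ℝ) :
    ‖expect θ f‖ₑ ≤ ∫⁻ x, componentENN θ x * ‖f x‖ₑ := by
  simp_rw [← enorm_component_mul]
  exact enorm_integral_le_lintegral_enorm _

/-- Smoothing is bounded from a Gaussian-weighted `L¹` to `L¹` of the cube, with one constant for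
all `σ ≤ 0`: after `component_le_mul` and Tonelli, the factor involving the mean integrates to one.
The weight is needed because `log p` is integrable only against Gaussians. -/
lemma exists_lintegral_cube_enorm_expect_le (R : ℝ) : ∃ C : ENNReal, C ≠ ⊤ ∧
    ∀ σ : Fin n → ℝ, σ ≤ 0 → ∀ h : (Fin n → ℝ) → ℝ, Measurable h →
      ∫⁻ μ in cube n R, ‖expect (μ, σ) h‖ₑ ≤
        C * ∫⁻ x, componentENN (0, widen fun _ => 0) x * ‖h x‖ₑ := by
  obtain ⟨C, hC, hle⟩ := component_le_mul (n := n) R 0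
  refine ⟨ENNReal.ofReal C, ENNReal.ofReal_ne_top, fun σ hσ h hh => ?_⟩
  have hq : Measurable fun z : (Fin n → ℝ) × (Fin n → ℝ) => componentENN (z.1, widen σ) z.2 := by
    fun_prop
  set k : (Fin n → ℝ) → ENNReal := fun x => componentENN (0, widen fun _ => 0) x * ‖h x‖ₑ
  have hk : Measurable k := (measurable_componentENN _).mul hh.enorm
  calc ∫⁻ μ in cube n R, ‖expect (μ, σ) h‖ₑ
      ≤ ∫⁻ μ in cube n R, ∫⁻ x, ENNReal.ofReal C * (k x * componentENN (μ, widen σ) x) := by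
        refine setLIntegral_mono' (measurableSet_cube R) fun μ hμ => ?_
        refine (enorm_expect_le _ _).trans (lintegral_mono fun x => ?_)
        have h1 := ENNReal.ofReal_le_ofReal (hle (μ, σ) x (mem_cube.1 hμ) fun i => hσ i)
        rw [ENNReal.ofReal_mul hC.le, ENNReal.ofReal_mul (component_pos _ _).le] at h1
        calc componentENN (μ, σ) x * ‖h x‖ₑ
            ≤ (ENNReal.ofReal C * (componentENN (0, widen fun _ => 0) x *
              componentENN (μ, widen σ) x)) * ‖h x‖ₑ := by gcongr; exact h1
          _ = _ := by simp only [k]; ring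
    _ ≤ ∫⁻ μ, ∫⁻ x, ENNReal.ofReal C * (k x * componentENN (μ, widen σ) x) :=
        setLIntegral_le_lintegral _ _
    _ = ∫⁻ x, ∫⁻ μ, ENNReal.ofReal C * (k x * componentENN (μ, widen σ) x) :=
        lintegral_lintegral_swap
          (((hk.comp measurable_snd).mul hq).const_mul _).aemeasurable
    _ = ∫⁻ x, ENNReal.ofReal C * k x := by
        refine lintegral_congr fun x => ?_
        have hx : Measurable fun μ => componentENN (μ, widen σ) x := by fun_prop
        rw [lintegral_const_mul _ (hx.const_mul _), lintegral_const_mul _ hx,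
          lintegral_componentENN_mean, mul_one]
    _ = _ := lintegral_const_mul _ hk

lemma continuous_component (θ : Param n) : Continuous (component θ) := by
  unfold component
  simp only [gaussianPDFReal_exp]
  fun_prop

/-- A positive continuous weight is bounded below on a compact cube. -/
lemma exists_lintegral_cube_enorm_le (R : ℝ) (θ : Param n) : ∃ C : ENNReal, C ≠ ⊤ ∧
    ∀ h : (Fin n → ℝ) → ℝ, Measurable h →
      ∫⁻ x in cube n R, ‖h x‖ₑ ≤ C * ∫⁻ x, componentENN θ x * ‖h x‖ₑ := by
  obtain ⟨c, hc, hle⟩ : ∃ c : ℝ, 0 < c ∧ ∀ x ∈ cube n R, c ≤ component θ x := by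
    rcases (cube n R).eq_empty_or_nonempty with he | hne
    · exact ⟨1, one_pos, by simp [he]⟩
    · obtain ⟨x, _, hx⟩ := (isCompact_cube R).exists_isMinOn hne
        (continuous_component θ).continuousOn
      exact ⟨_, component_pos θ x, fun y hy => hx hy⟩
  refine ⟨ENNReal.ofReal c⁻¹, ENNReal.ofReal_ne_top, fun h hh => ?_⟩
  rw [← lintegral_const_mul' _ _ ENNReal.ofReal_ne_top]
  refine (setLIntegral_mono' (measurableSet_cube R) fun x hx => ?_).trans
    (setLIntegral_le_lintegral _ _)
  rw [← mul_assoc, componentENN, ← ENNReal.ofReal_mul (inv_pos.2 hc).le]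
  refine le_mul_of_one_le_left' ?_
  rw [ENNReal.one_le_ofReal, ← div_eq_inv_mul, one_le_div hc]
  exact hle x hx

lemma integrable_component_mul_of_bounded (θ : Param n) {g : (Fin n → ℝ) → ℝ} (hg : Measurable g)
    {B : ℝ} (hB : ∀ x, ‖g x‖ ≤ B) : Integrable fun x => component θ x * g x := by
  simp_rw [mul_comm (component θ _)]
  exact (integrable_component θ).bdd_mul hg.aestronglyMeasurable (ae_of_all _ hB)

/-- Uniform continuity handles points within `δ` of the mean. Farther away some coordinate differs
by at least `δ`, so `|g x - g μ| ≤ 2B` is at most `2B/δ²` times the squared distance, whose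
expectation is a sum of variances. -/
lemma eventually_abs_expect_sub_le {g : (Fin n → ℝ) → ℝ} (hg : Continuous g)
    (hcs : HasCompactSupport g) {ε : ℝ} (hε : 0 < ε) :
    ∀ᶠ σ : Fin n → ℝ in atBot, ∀ μ, |expect (μ, σ) g - g μ| ≤ ε := by
  obtain ⟨B, hB⟩ := hcs.exists_bound_of_continuous hg
  have hB0 : 0 ≤ B := (norm_nonneg _).trans (hB 0)
  obtain ⟨δ, hδ, hδg⟩ := Metric.uniformContinuous_iff.1
    (hcs.uniformContinuous_of_continuous hg) (ε / 2) (by positivity)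
  set K := 2 * B / δ ^ 2 with hK
  have hK0 : 0 ≤ K := by positivity
  have hpt : ∀ μ x : Fin n → ℝ, |g x - g μ| ≤ ε / 2 + ∑ i, K * (x i - μ i) ^ 2 := by
    intro μ x
    have hs : 0 ≤ ∑ i, K * (x i - μ i) ^ 2 := Finset.sum_nonneg fun i _ => by positivity
    by_cases hd : dist x μ < δ
    · have := (hδg hd).le
      rw [Real.dist_eq] at this
      linarith
    · rw [dist_pi_lt_iff hδ] at hd
      push Not at hd
      obtain ⟨i, hi⟩ := hd
      rw [Real.dist_eq] at hi
      have h1 : K * (x i - μ i) ^ 2 ≤ ∑ i, K * (x i - μ i) ^ 2 :=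
        Finset.single_le_sum (f := fun i => K * (x i - μ i) ^ 2) (fun i _ => by positivity)
          (Finset.mem_univ i)
      have h2 : 2 * B ≤ K * (x i - μ i) ^ 2 := by
        have : δ ^ 2 ≤ (x i - μ i) ^ 2 := by
          rw [← sq_abs (x i - μ i)]; gcongr
        calc 2 * B = K * δ ^ 2 := by rw [hK]; field_simp
          _ ≤ _ := by gcongr
      have h3 : |g x - g μ| ≤ 2 * B := by
        have := abs_sub (g x) (g μ)
        have e1 := hB x
        have e2 := hB μ
        rw [Real.norm_eq_abs] at e1 e2
        linarith
      linarith
  set t := ε / 2 / (n * K + 1) with ht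
  have ht0 : 0 < t := by positivity
  filter_upwards [eventually_le_atBot fun _ => Real.log t / 2] with σ hσ μ
  have hgm := hg.measurable
  have e : expect (μ, σ) g - g μ = ∫ x, component (μ, σ) x * (g x - g μ) := by
    simp_rw [mul_sub]
    rw [integral_sub (integrable_component_mul_of_bounded _ hgm hB)
      ((integrable_component _).mul_const _), integral_mul_const, integral_component, one_mul]
    rfl
  have hq := expect_quadratic (μ, σ) (fun _ => 0) (fun _ => 0) (fun _ => K)
  simp only [zero_mul, zero_add, expect] at hq
  rw [e]
  calc |∫ x, component (μ, σ) x * (g x - g μ)|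
      ≤ ∫ x, |component (μ, σ) x * (g x - g μ)| := abs_integral_le_integral_abs
    _ ≤ ∫ x, (component (μ, σ) x * (ε / 2) +
          component (μ, σ) x * ∑ i, K * (x i - μ i) ^ 2) := by
        refine integral_mono_of_nonneg (ae_of_all _ fun _ => abs_nonneg _)
          (((integrable_component _).mul_const _).add hq.2) (ae_of_all _ fun x => ?_)
        dsimp only
        rw [abs_mul, abs_of_pos (component_pos _ _), ← mul_add]
        exact mul_le_mul_of_nonneg_left (hpt μ x) (component_pos _ _).le
    _ = ε / 2 + ∑ i, K * Real.exp (2 * σ i) := by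
        rw [integral_add ((integrable_component _).mul_const _) hq.2, integral_mul_const,
          integral_component, one_mul, hq.1]
    _ ≤ ε / 2 + ∑ _i : Fin n, K * t := by
        gcongr with i
        rw [← Real.le_log_iff_exp_le ht0]
        have := hσ i
        linarith
    _ ≤ ε := by
        simp only [Finset.sum_const, Finset.card_univ, Fintype.card_fin, nsmul_eq_mul]
        have h1 : (n * K + 1) * t = ε / 2 := by rw [ht]; field_simp
        nlinarith

/-- Gaussian smoothing converges in `L¹` on cubes, jointly in all scales. -/
theorem tendsto_lintegral_cube_expect_sub {f : (Fin n → ℝ) → ℝ} (hf : Measurable f)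
    (hint : ∀ θ : Param n, Integrable fun x => component θ x * f x) (R : ℝ) :
    Tendsto (fun σ => ∫⁻ μ in cube n R, ‖expect (μ, σ) f - f μ‖ₑ) atBot (𝓝 0) := by
  set θ₀ : Param n := (0, widen fun _ => 0) with hθ₀
  obtain ⟨C, hC, hCle⟩ := exists_lintegral_cube_enorm_expect_le (n := n) R
  obtain ⟨D, hD, hDle⟩ := exists_lintegral_cube_enorm_le (n := n) R θ₀
  rw [ENNReal.tendsto_nhds_zero]
  intro ε hε
  obtain ⟨η, hη, hηle⟩ : ∃ η : ENNReal, η ≠ 0 ∧ (C + D) * η ≤ ε / 2 := by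
    obtain ⟨η, h1, h2⟩ := ENNReal.exists_nnreal_pos_mul_lt (a := C + D) (b := ε / 2)
      (by simp [hC, hD]) (by simpa using hε.ne')
    exact ⟨η, by simpa using h1.ne', (mul_comm _ _).trans_le h2.le⟩
  set ν : Measure (Fin n → ℝ) := volume.withDensity (componentENN θ₀)
  have : IsFiniteMeasure ν := isFiniteMeasure_withDensity (by simp [lintegral_componentENN])
  have hfν : Integrable f ν := by
    rw [integrable_withDensity_iff_integrable_smul' (measurable_componentENN _)
      (ae_of_all _ fun _ => ENNReal.ofReal_lt_top)]
    simpa [componentENN, (component_pos _ _).le] using hint θ₀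
  -- Density argument in the weighted `L¹`: the two preceding bounds control `f - g` before and
  -- after smoothing, uniformly in `σ ≤ 0`, and the smoothing of `g` converges uniformly.
  obtain ⟨g, hgc, hgle, hg, -⟩ := hfν.exists_hasCompactSupport_lintegral_sub_le hη
  obtain ⟨B, hB⟩ := hgc.exists_bound_of_continuous hg
  set h : (Fin n → ℝ) → ℝ := fun x => f x - g x
  have hh : Measurable h := hf.sub hg.measurable
  have hle : ∫⁻ x, componentENN θ₀ x * ‖h x‖ₑ ≤ η := by
    rw [lintegral_withDensity_eq_lintegral_mul _ (measurable_componentENN _) hh.enorm] at hgle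
    exact hgle
  obtain ⟨κ, hκ, hκle⟩ : ∃ κ : ℝ, 0 < κ ∧ ENNReal.ofReal κ * volume (cube n R) ≤ ε / 2 := by
    obtain ⟨κ, h1, h2⟩ := ENNReal.exists_nnreal_pos_mul_lt (volume_cube_ne_top (n := n) R)
      (b := ε / 2) (by simpa using hε.ne')
    exact ⟨κ, by exact_mod_cast h1, by simpa using h2.le⟩
  filter_upwards [eventually_le_atBot 0, eventually_abs_expect_sub_le hg hgc hκ] with σ hσ hσg
  have hpt : ∀ μ, ‖expect (μ, σ) f - f μ‖ₑ ≤ ‖expect (μ, σ) h‖ₑ + ‖h μ‖ₑ + ENNReal.ofReal κ := by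
    intro μ
    have e : expect (μ, σ) f - f μ = expect (μ, σ) h - h μ + (expect (μ, σ) g - g μ) := by
      have : expect (μ, σ) h = expect (μ, σ) f - expect (μ, σ) g := by
        unfold expect
        simp only [h, mul_sub]
        exact integral_sub (hint _) (integrable_component_mul_of_bounded _ hg.measurable hB)
      rw [this]
      simp only [h]
      ring
    rw [e]
    refine (enorm_add_le _ _).trans (add_le_add enorm_sub_le ?_)
    rw [← ofReal_norm]
    exact ENNReal.ofReal_le_ofReal (hσg μ)
  calc ∫⁻ μ in cube n R, ‖expect (μ, σ) f - f μ‖ₑ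
      ≤ ∫⁻ μ in cube n R, (‖expect (μ, σ) h‖ₑ + ‖h μ‖ₑ + ENNReal.ofReal κ) := lintegral_mono hpt
    _ = (∫⁻ μ in cube n R, ‖expect (μ, σ) h‖ₑ) + (∫⁻ μ in cube n R, ‖h μ‖ₑ) +
          ENNReal.ofReal κ * volume (cube n R) := by
        rw [lintegral_add_right _ measurable_const, lintegral_add_right _ hh.enorm,
          setLIntegral_const]
    _ ≤ C * η + D * η + ε / 2 := by
        gcongr
        · exact (hCle σ hσ h hh).trans (by gcongr)
        · exact (hDle h hh).trans (by gcongr)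
    _ ≤ ε / 2 + ε / 2 := by rw [← add_mul]; gcongr
    _ = ε := ENNReal.add_halves ε

/-! ### Jensen's inequality for the negative cross-entropy -/

/-- Integrate `log t ≤ t - 1` at `t = r x / A`, with `A` the mean of `r`; if `r` has no finite mean
the right side is infinite. It is applied to both `p` and `√p`. -/
lemma ofReal_exp_expect_log_le {r : (Fin n → ℝ) → ℝ} (hr : Measurable r) (hr0 : ∀ x, 0 ≤ r x)
    (hr_pos : ∀ᵐ x, 0 < r x) (θ : Param n)
    (hlog : Integrable fun x => component θ x * Real.log (r x)) :
    ENNReal.ofReal (Real.exp (expect θ fun x => Real.log (r x))) ≤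
      ∫⁻ x, componentENN θ x * ENNReal.ofReal (r x) := by
  have hnn : ∀ x, 0 ≤ component θ x * r x := fun x => mul_nonneg (component_pos _ _).le (hr0 x)
  have e : ∫⁻ x, componentENN θ x * ENNReal.ofReal (r x) =
      ∫⁻ x, ENNReal.ofReal (component θ x * r x) :=
    lintegral_congr fun x => by rw [componentENN, ENNReal.ofReal_mul (component_pos _ _).le]
  by_cases hint : Integrable fun x => component θ x * r x
  · rw [e, ← ofReal_integral_eq_lintegral_ofReal hint (ae_of_all _ hnn)]
    refine ENNReal.ofReal_le_ofReal ?_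
    set A := ∫ x, component θ x * r x with hA
    have hA0 : 0 < A := by
      refine lt_of_le_of_ne (integral_nonneg hnn) fun h0 => ?_
      have h1 := (integral_eq_zero_iff_of_nonneg hnn hint).1 h0.symm
      obtain ⟨x, hx1, hx2⟩ := (h1.and hr_pos).exists
      exact (mul_pos (component_pos θ x) hx2).ne' hx1
    rw [← Real.le_log_iff_exp_le hA0]
    calc expect θ (fun x => Real.log (r x))
        ≤ ∫ x, ((Real.log A - 1) * component θ x + A⁻¹ * (component θ x * r x)) := by
          refine integral_mono_ae hlog
            (((integrable_component θ).const_mul _).add (hint.const_mul _)) ?_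
          filter_upwards [hr_pos] with x hx
          have h1 := Real.log_le_sub_one_of_pos (div_pos hx hA0)
          rw [Real.log_div hx.ne' hA0.ne', div_eq_inv_mul] at h1
          have h2 := mul_le_mul_of_nonneg_left h1 (component_pos θ x).le
          linarith
      _ = Real.log A := by
          rw [integral_add ((integrable_component θ).const_mul _) (hint.const_mul _),
            integral_const_mul, integral_const_mul, integral_component, ← hA,
            inv_mul_cancel₀ hA0.ne']
          ring
  · have : ∫⁻ x, componentENN θ x * ENNReal.ofReal (r x) = ⊤ := by
      by_contra hne
      rw [e] at hne
      refine hint ⟨((measurable_component θ).mul hr).aestronglyMeasurable, ?_⟩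
      rw [hasFiniteIntegral_iff_ofReal (ae_of_all _ hnn)]
      exact lt_top_iff_ne_top.2 hne
    rw [this]
    exact le_top

end Smoothing

/-! ### Total variation and one-sided deficits -/

/-- Since `f` has no more mass than `g`, its excess over `g` is at most its deficit, and `|f - g|`
is the sum of the two. The comparison is read off from `(f - g)⁺ + g = max f g = (g - f)⁺ + f`. -/
lemma lintegral_enorm_sub_le {α : Type*} [MeasurableSpace α] {μ : Measure α} {f g : α → ℝ}
    (hf : AEMeasurable f μ) (hg : AEMeasurable g μ) (hf0 : ∀ x, 0 ≤ f x) (hg0 : ∀ x, 0 ≤ g x)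
    (hle : ∫⁻ x, ENNReal.ofReal (f x) ∂μ ≤ ∫⁻ x, ENNReal.ofReal (g x) ∂μ)
    (hfin : ∫⁻ x, ENNReal.ofReal (g x) ∂μ ≠ ⊤) :
    ∫⁻ x, ‖f x - g x‖ₑ ∂μ ≤ 2 * ∫⁻ x, (ENNReal.ofReal (g x) - ENNReal.ofReal (f x)) ∂μ := by
  have hF := hf.ennreal_ofReal
  have hG := hg.ennreal_ofReal
  have e1 : ∫⁻ x, ‖f x - g x‖ₑ ∂μ =
      (∫⁻ x, (ENNReal.ofReal (f x) - ENNReal.ofReal (g x)) ∂μ) +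
        ∫⁻ x, (ENNReal.ofReal (g x) - ENNReal.ofReal (f x)) ∂μ := by
    have hFG : AEMeasurable (fun x => ENNReal.ofReal (f x) - ENNReal.ofReal (g x)) μ := hF.sub hG
    rw [← lintegral_add_left' hFG]
    refine lintegral_congr fun x => ?_
    rw [← ENNReal.ofReal_sub _ (hg0 x), ← ENNReal.ofReal_sub _ (hf0 x), ← ofReal_norm,
      Real.norm_eq_abs]
    rcases le_total (f x) (g x) with h | h
    · rw [abs_of_nonpos (by linarith), ENNReal.ofReal_of_nonpos (by linarith : f x - g x ≤ 0),
        zero_add, neg_sub]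
    · rw [abs_of_nonneg (by linarith), ENNReal.ofReal_of_nonpos (by linarith : g x - f x ≤ 0),
        add_zero]
  have e2 : (∫⁻ x, (ENNReal.ofReal (f x) - ENNReal.ofReal (g x)) ∂μ) +
      ∫⁻ x, ENNReal.ofReal (g x) ∂μ ≤
      (∫⁻ x, (ENNReal.ofReal (g x) - ENNReal.ofReal (f x)) ∂μ) +
        ∫⁻ x, ENNReal.ofReal (g x) ∂μ := by
    refine le_trans ?_ (add_le_add le_rfl hle)
    rw [← lintegral_add_right' _ hG, ← lintegral_add_right' _ hF]
    refine lintegral_mono fun x => ?_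
    rw [tsub_add_eq_max, tsub_add_eq_max, max_comm]
  have e3 := (ENNReal.add_le_add_iff_right hfin).1 e2
  rw [e1, two_mul]
  exact add_le_add e3 le_rfl

lemma sq_lintegral_le_lintegral_sq {α : Type*} [MeasurableSpace α] {ν : Measure α}
    (hν : ν Set.univ ≤ 1) {g : α → ENNReal} (hg : AEMeasurable g ν) :
    (∫⁻ x, g x ∂ν) ^ 2 ≤ ∫⁻ x, g x ^ 2 ∂ν := by
  have h := ENNReal.lintegral_mul_le_Lp_mul_Lq ν Real.HolderConjugate.two_two
    (aemeasurable_const (b := (1 : ENNReal))) hg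
  simp only [Pi.mul_apply, one_mul, ENNReal.rpow_two, one_pow, lintegral_one] at h
  have h1 : ν Set.univ ^ (1 / 2 : ℝ) ≤ 1 := ENNReal.rpow_le_one hν (by norm_num)
  calc (∫⁻ x, g x ∂ν) ^ 2 ≤ (1 * (∫⁻ x, g x ^ 2 ∂ν) ^ (1 / 2 : ℝ)) ^ 2 := by
        gcongr
        exact h.trans (by gcongr)
    _ = _ := by
        rw [one_mul, ← ENNReal.rpow_two, ← ENNReal.rpow_mul]
        norm_num

lemma ENNReal.add_sq_le_two_mul (a b : ENNReal) : (a + b) ^ 2 ≤ 2 * (a ^ 2 + b ^ 2) := by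
  have h := ENNReal.rpow_add_le_mul_rpow_add_rpow a b (p := 2) one_le_two
  simp only [ENNReal.rpow_two] at h
  convert h using 2
  norm_num

section Weight
variable {n : ℕ}

/-! ### The negative cross-entropy weight -/

/-- By Tonelli the mean is integrated out first, and each component has mass one in its mean. -/
lemma lintegral_componentENN_mul_swap (σ : Fin n → ℝ) {s : Set (Fin n → ℝ)}
    {h : (Fin n → ℝ) → ENNReal} (hh : Measurable h) :
    ∫⁻ μ, ∫⁻ x in s, componentENN (μ, σ) x * h x = ∫⁻ x in s, h x := by
  have hm : Measurable fun z : (Fin n → ℝ) × (Fin n → ℝ) =>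
      componentENN (z.1, σ) z.2 * h z.2 := by fun_prop
  rw [lintegral_lintegral_swap hm.aemeasurable]
  refine lintegral_congr fun x => ?_
  rw [lintegral_mul_const _ (by fun_prop), lintegral_componentENN_mean, one_mul]

/-- An almost everywhere positive probability density whose logarithm is integrable against every
component. -/
structure IsLogIntegrableDensity (p : (Fin n → ℝ) → ℝ) : Prop where
  measurable : Measurable p
  nonneg : ∀ x, 0 ≤ p x
  pos : ∀ᵐ x, 0 < p x
  integrable : Integrable p
  integral_eq_one : ∫ x, p x = 1
  log : ∀ θ : Param n, Integrable fun x => component θ x * Real.log (p x)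

/-- The weight `exp (E_q[log p])` with values in `[0, ∞]`. -/
def weightENN (p : (Fin n → ℝ) → ℝ) (θ : Param n) : ENNReal := ENNReal.ofReal (negCEWeight p θ)

/-- The mass of `p` which is not covered by the weight at scale `σ`. -/
def deficit (p : (Fin n → ℝ) → ℝ) (σ : Fin n → ℝ) : ENNReal :=
  ∫⁻ μ, (ENNReal.ofReal (p μ) - weightENN p (μ, σ))

lemma negCEWeight_pos (p : (Fin n → ℝ) → ℝ) (θ : Param n) : 0 < negCEWeight p θ := Real.exp_pos _

/-- The part of the cube `[-M, M]ⁿ` where `p` is at most `M`. -/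
def truncationSet (p : (Fin n → ℝ) → ℝ) (M : ℝ) : Set (Fin n → ℝ) := cube n M ∩ {x | p x ≤ M}

namespace IsLogIntegrableDensity

variable {p : (Fin n → ℝ) → ℝ} (hp : IsLogIntegrableDensity p)
include hp

lemma measurable_negCEWeight : Measurable (negCEWeight p) :=
  (measurable_expect (Real.measurable_log.comp hp.measurable)).exp

lemma measurable_weightENN : Measurable (weightENN p) := hp.measurable_negCEWeight.ennreal_ofReal

lemma measurable_weightENN_mean (σ : Fin n → ℝ) : Measurable fun μ => weightENN p (μ, σ) :=
  hp.measurable_weightENN.comp measurable_prodMk_right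

lemma lintegral_eq_one : ∫⁻ x, ENNReal.ofReal (p x) = 1 := by
  rw [← ofReal_integral_eq_lintegral_ofReal hp.integrable (ae_of_all _ hp.nonneg),
    hp.integral_eq_one, ENNReal.ofReal_one]

lemma measurable_ofReal : Measurable fun x => ENNReal.ofReal (p x) := hp.measurable.ennreal_ofReal

lemma weightENN_le (θ : Param n) :
    weightENN p θ ≤ ∫⁻ x, componentENN θ x * ENNReal.ofReal (p x) :=
  ofReal_exp_expect_log_le hp.measurable hp.nonneg hp.pos θ (hp.log θ)

lemma lintegral_weightENN_le_one (σ : Fin n → ℝ) : ∫⁻ μ, weightENN p (μ, σ) ≤ 1 := by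
  refine (lintegral_mono fun μ => hp.weightENN_le (μ, σ)).trans ?_
  have h := lintegral_componentENN_mul_swap σ (s := Set.univ) hp.measurable_ofReal
  simp only [Measure.restrict_univ] at h
  rw [h, hp.lintegral_eq_one]

lemma deficit_le_one (σ : Fin n → ℝ) : deficit p σ ≤ 1 := by
  rw [← hp.lintegral_eq_one]
  exact lintegral_mono fun μ => tsub_le_self

lemma measurable_deficit : Measurable (deficit p) :=
  Measurable.lintegral_prod_right' (f := fun z : (Fin n → ℝ) × (Fin n → ℝ) =>
    ENNReal.ofReal (p z.2) - weightENN p (z.2, z.1))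
    ((hp.measurable_ofReal.comp measurable_snd).sub
      (hp.measurable_weightENN.comp measurable_swap))

lemma measurableSet_truncationSet (M : ℝ) : MeasurableSet (truncationSet p M) :=
  (measurableSet_cube M).inter (measurableSet_le hp.measurable measurable_const)

lemma exists_lintegral_compl_truncationSet_le {ε : ENNReal} (hε : ε ≠ 0) :
    ∃ M : ℝ, 0 ≤ M ∧ ∫⁻ x in (truncationSet p M)ᶜ, ENNReal.ofReal (p x) ≤ ε := by
  have : IsFiniteMeasure (volume.withDensity fun x => ENNReal.ofReal (p x)) :=
    isFiniteMeasure_withDensity (by simp [hp.lintegral_eq_one])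
  have h := tendsto_measure_iInter_atTop
    (μ := volume.withDensity fun x => ENNReal.ofReal (p x))
    (s := fun m : ℕ => (truncationSet p (m : ℝ))ᶜ)
    (fun m => (hp.measurableSet_truncationSet _).compl.nullMeasurableSet)
    (fun k m hkm x hx hx' => hx ⟨mem_cube.2 fun i => (mem_cube.1 hx'.1 i).trans
      (by exact_mod_cast hkm), (show p x ≤ _ from hx'.2).trans (by exact_mod_cast hkm)⟩)
    ⟨0, measure_ne_top _ _⟩
  have hemp : ⋂ m : ℕ, (truncationSet p (m : ℝ))ᶜ = ∅ := by
    refine Set.eq_empty_of_forall_notMem fun x hx => ?_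
    obtain ⟨m, hm⟩ := exists_nat_ge (max (p x) (∑ i, |x i|))
    refine Set.mem_iInter.1 hx m ⟨mem_cube.2 fun i => ?_, (le_max_left _ _).trans hm⟩
    exact (Finset.single_le_sum (f := fun i => |x i|) (fun i _ => abs_nonneg _)
      (Finset.mem_univ i)).trans ((le_max_right _ _).trans hm)
  rw [hemp, measure_empty, ENNReal.tendsto_nhds_zero] at h
  obtain ⟨m, hm⟩ := (h ε (pos_iff_ne_zero.2 hε)).exists
  refine ⟨m, m.cast_nonneg, ?_⟩
  rwa [Function.comp_apply, withDensity_apply _ (hp.measurableSet_truncationSet _).compl] at hm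

lemma tendsto_lintegral_compl_cube :
    Tendsto (fun a => ∫⁻ x in (cube n a)ᶜ, ENNReal.ofReal (p x)) atTop (𝓝 0) := by
  rw [ENNReal.tendsto_nhds_zero]
  intro ε hε
  obtain ⟨M, -, hM⟩ := hp.exists_lintegral_compl_truncationSet_le hε.ne'
  filter_upwards [eventually_ge_atTop M] with a ha
  refine (lintegral_mono_set ?_).trans hM
  refine Set.compl_subset_compl.2 fun x hx => mem_cube.2 fun i => ?_
  exact (mem_cube.1 hx.1 i).trans ha

/-- Where `p > 0`, `w = p * exp (E - log p) ≥ p * (1 + E - log p)`, so the shortfall is at most `p *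
|E - log p|`. Truncating at `p ≤ M` turns `L¹` convergence of the logarithms into convergence of the
deficit. -/
lemma ofReal_sub_weightENN_le {M : ℝ} {x : Fin n → ℝ} (hx : p x ≤ M) (σ : Fin n → ℝ) :
    ENNReal.ofReal (p x) - weightENN p (x, σ) ≤ ENNReal.ofReal M *
      ‖expect (x, σ) (fun y => Real.log (p y)) - Real.log (p x)‖ₑ := by
  rcases (hp.nonneg x).eq_or_lt with h0 | h0
  · simp [← h0]
  rw [weightENN, ← ENNReal.ofReal_sub _ (negCEWeight_pos _ _).le, ← ofReal_norm,
    ← ENNReal.ofReal_mul (h0.le.trans hx)]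
  refine ENNReal.ofReal_le_ofReal ?_
  set E := expect (x, σ) (fun y => Real.log (p y)) with hE
  have h1 : negCEWeight p (x, σ) = p x * Real.exp (E - Real.log (p x)) := by
    rw [Real.exp_sub, Real.exp_log h0, negCEWeight]
    field_simp
    rfl
  have h2 := Real.add_one_le_exp (E - Real.log (p x))
  have h3 := neg_abs_le (E - Real.log (p x))
  rw [h1, Real.norm_eq_abs]
  have h4 : p x * |E - Real.log (p x)| ≤ M * |E - Real.log (p x)| := by gcongr
  nlinarith

/-- At narrow scales the weight covers `p`. -/
theorem tendsto_deficit : Tendsto (deficit p) atBot (𝓝 0) := by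
  rw [ENNReal.tendsto_nhds_zero]
  intro ε hε
  obtain ⟨M, hM0, hM⟩ := hp.exists_lintegral_compl_truncationSet_le
    (ENNReal.half_pos hε.ne').ne'
  have h := ENNReal.Tendsto.const_mul (a := ENNReal.ofReal M) (tendsto_lintegral_cube_expect_sub
    (Real.measurable_log.comp hp.measurable) hp.log M) (Or.inr ENNReal.ofReal_ne_top)
  rw [mul_zero, ENNReal.tendsto_nhds_zero] at h
  filter_upwards [h (ε / 2) (ENNReal.half_pos hε.ne')] with σ hσ
  -- On the truncation set the smoothing theorem applies; off it the integrand is at most `p`, whose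
  -- mass there is at most `ε / 2`.
  rw [deficit, ← lintegral_add_compl _ (hp.measurableSet_truncationSet M), ← ENNReal.add_halves ε]
  refine add_le_add ?_ ((lintegral_mono fun μ => tsub_le_self).trans hM)
  refine le_trans ?_ hσ
  rw [← lintegral_const_mul' _ _ ENNReal.ofReal_ne_top]
  exact (setLIntegral_mono' (hp.measurableSet_truncationSet M) fun x hx =>
    hp.ofReal_sub_weightENN_le hx.2 σ).trans (lintegral_mono_set Set.inter_subset_left)

lemma one_le_lintegral_weightENN_add (σ : Fin n → ℝ) (a : ℝ) :
    1 ≤ (∫⁻ μ in cube n a, weightENN p (μ, σ)) +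
      (deficit p σ + ∫⁻ x in (cube n a)ᶜ, ENNReal.ofReal (p x)) := by
  rw [← hp.lintegral_eq_one, ← lintegral_add_compl _ (measurableSet_cube a), ← add_assoc]
  refine add_le_add ?_ le_rfl
  refine le_trans ?_ (add_le_add le_rfl (setLIntegral_le_lintegral (cube n a) _))
  rw [← lintegral_add_left (hp.measurable_weightENN_mean σ)]
  exact lintegral_mono fun μ => le_add_tsub

lemma integrable_negCEWeight_mean (σ : Fin n → ℝ) :
    Integrable fun μ => negCEWeight p (μ, σ) := by
  refine ⟨(hp.measurable_negCEWeight.comp measurable_prodMk_right).aestronglyMeasurable, ?_⟩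
  rw [hasFiniteIntegral_iff_ofReal (ae_of_all _ fun μ => (negCEWeight_pos _ _).le)]
  exact (hp.lintegral_weightENN_le_one σ).trans_lt ENNReal.one_lt_top

/-- Given a narrow scale, the mean is distributed according to `p`. -/
theorem tendsto_conditional : Tendsto (fun σ : Fin n → ℝ =>
    ∫⁻ μ, ‖negCEWeight p (μ, σ) / (∫ μ', negCEWeight p (μ', σ)) - p μ‖ₑ) atBot (𝓝 0) := by
  have h := ENNReal.Tendsto.const_mul (a := 2) hp.tendsto_deficit (Or.inr ENNReal.ofNat_ne_top)
  rw [mul_zero] at h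
  refine tendsto_of_tendsto_of_tendsto_of_le_of_le tendsto_const_nhds h (fun _ => zero_le)
    fun σ => ?_
  have hint := hp.integrable_negCEWeight_mean σ
  set V := ∫ μ', negCEWeight p (μ', σ) with hV
  have hV0 : 0 < V := integral_exp_pos hint
  have hV1 : V ≤ 1 := by
    rw [← ENNReal.ofReal_le_ofReal_iff zero_le_one, hV, ofReal_integral_eq_lintegral_ofReal hint
      (ae_of_all _ fun μ => (negCEWeight_pos _ _).le), ENNReal.ofReal_one]
    exact hp.lintegral_weightENN_le_one σ
  refine (lintegral_enorm_sub_le (hint.aemeasurable.div_const _) hp.measurable.aemeasurable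
    (fun μ => div_nonneg (negCEWeight_pos _ _).le hV0.le) hp.nonneg ?_ ?_).trans ?_
  · rw [hp.lintegral_eq_one, ← ofReal_integral_eq_lintegral_ofReal (hint.div_const _)
      (ae_of_all _ fun μ => div_nonneg (negCEWeight_pos _ _).le hV0.le), integral_div, ← hV,
      div_self hV0.ne', ENNReal.ofReal_one]
  · simp [hp.lintegral_eq_one]
  -- Because `V ≤ 1`, normalising can only raise the weight, hence lower its deficit.
  · refine mul_le_mul_right (lintegral_mono fun μ => tsub_le_tsub_left ?_ _) 2
    refine ENNReal.ofReal_le_ofReal ?_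
    rw [le_div_iff₀ hV0]
    nlinarith [negCEWeight_pos p (μ, σ)]

end IsLogIntegrableDensity

/-! ### Wide scales carry little mass -/

/-- Only coordinate `i` is used: its marginal has density at most `exp (-σ i)` on an interval of
length `2R`. The bound is therefore uniform in the other scales. -/
lemma lintegral_cube_componentENN_le (θ : Param n) (i : Fin n) {R : ℝ} (hR : 0 ≤ R) :
    ∫⁻ x in cube n R, componentENN θ x ≤ ENNReal.ofReal (2 * R * Real.exp (-θ.2 i)) := by
  set h : ℝ → ℝ := (Set.Icc (-R) R).indicator 1 with hh
  have hh0 : ∀ y, 0 ≤ h y := fun y => Set.indicator_nonneg (fun _ _ => zero_le_one) y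
  have hint : Integrable h := (integrable_indicator_iff measurableSet_Icc).2
    (integrableOn_const (by simp) (by simp))
  have hle : ∀ y, gaussianPDFReal (θ.1 i) (Real.exp (2 * θ.2 i)).toNNReal y * h y ≤
      Real.exp (-θ.2 i) * h y := fun y =>
    mul_le_mul_of_nonneg_right (gaussianPDFReal_le_exp_neg _ _ _) (hh0 y)
  have hint' : Integrable fun y =>
      gaussianPDFReal (θ.1 i) (Real.exp (2 * θ.2 i)).toNNReal y * h y := by
    refine (hint.const_mul (Real.exp (-θ.2 i))).mono'
      ((measurable_gaussianPDFReal _ _).aestronglyMeasurable.mul hint.1) (ae_of_all _ fun y => ?_)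
    rw [Real.norm_of_nonneg (mul_nonneg (gaussianPDFReal_nonneg _ _ _) (hh0 y))]
    exact hle y
  calc ∫⁻ x in cube n R, componentENN θ x
      ≤ ∫⁻ x in cube n R, ENNReal.ofReal (component θ x * h (x i)) := by
        refine setLIntegral_mono' (measurableSet_cube R) fun x hx => ?_
        have : h (x i) = 1 := by
          simp [hh, Set.indicator_of_mem (Set.mem_Icc.2 (abs_le.1 (mem_cube.1 hx i)))]
        rw [this, mul_one, componentENN]
    _ ≤ ∫⁻ x, ENNReal.ofReal (component θ x * h (x i)) := setLIntegral_le_lintegral _ _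
    _ = ENNReal.ofReal (∫ x, component θ x * h (x i)) :=
        (ofReal_integral_eq_lintegral_ofReal (integrable_component_mul_coord θ i h hint')
          (ae_of_all _ fun x => mul_nonneg (component_pos _ _).le (hh0 _))).symm
    _ ≤ _ := by
        refine ENNReal.ofReal_le_ofReal ?_
        rw [integral_component_mul_coord]
        refine (integral_mono hint' (hint.const_mul _) hle).trans_eq ?_
        rw [integral_const_mul, hh, integral_indicator_one measurableSet_Icc]
        simp only [measureReal_def, Real.volume_Icc]
        rw [ENNReal.toReal_ofReal (by linarith)]
        ring

namespace IsLogIntegrableDensity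

variable {p : (Fin n → ℝ) → ℝ} (hp : IsLogIntegrableDensity p)
include hp

/-- `E[log p] = 2 E[log √p]`, followed by Jensen for `√p`. Jensen for `p` itself bounds the fibre
mass only by `1`; the square is what yields decay at wide scales. -/
lemma weightENN_le_sq (θ : Param n) :
    weightENN p θ ≤ (∫⁻ x, componentENN θ x * ENNReal.ofReal (√(p x))) ^ 2 := by
  have hlog : ∀ x, Real.log (√(p x)) = Real.log (p x) / 2 := fun x => Real.log_sqrt (hp.nonneg x)
  have h := ofReal_exp_expect_log_le (r := fun x => √(p x)) hp.measurable.sqrt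
    (fun x => Real.sqrt_nonneg _) (hp.pos.mono fun x hx => Real.sqrt_pos.2 hx) θ (by
      simp_rw [hlog, ← mul_div_assoc]
      exact (hp.log θ).div_const 2)
  refine le_trans (le_of_eq ?_) (pow_le_pow_left' h 2)
  rw [← ENNReal.ofReal_pow (Real.exp_pos _).le, ← Real.exp_nat_mul, weightENN, negCEWeight]
  simp_rw [expect, hlog, ← mul_div_assoc]
  rw [integral_div]
  congr 2
  push_cast
  ring

/-- On the truncation set `√p ≤ √M` gives `M I²`, with `I` the component's mass in the cube; one
factor `I` becomes the small `2M exp (-σ i)`, the other is kept so that the mean can be integrated.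
Off the set, Cauchy–Schwarz returns from `√p` to `p`, which has little mass there. -/
lemma weightENN_le_split (θ : Param n) {M : ℝ} (hM : 0 ≤ M) (i : Fin n) :
    weightENN p θ ≤ 2 * (ENNReal.ofReal (M * (2 * M * Real.exp (-θ.2 i))) *
      ∫⁻ x in cube n M, componentENN θ x) +
      2 * ∫⁻ x in (truncationSet p M)ᶜ, componentENN θ x * ENNReal.ofReal (p x) := by
  set T := truncationSet p M
  have hT : MeasurableSet T := hp.measurableSet_truncationSet M
  have h1 : ∫⁻ x in T, componentENN θ x * ENNReal.ofReal (√(p x)) ≤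
      ENNReal.ofReal (√M) * ∫⁻ x in cube n M, componentENN θ x := by
    rw [← lintegral_const_mul' _ _ ENNReal.ofReal_ne_top]
    refine (setLIntegral_mono' hT fun x hx => ?_).trans (lintegral_mono_set Set.inter_subset_left)
    rw [mul_comm]
    gcongr
    exact hx.2
  have h2 : (∫⁻ x in Tᶜ, componentENN θ x * ENNReal.ofReal (√(p x))) ^ 2 ≤
      ∫⁻ x in Tᶜ, componentENN θ x * ENNReal.ofReal (p x) := by
    have hν : ((volume.withDensity (componentENN θ)).restrict Tᶜ) Set.univ ≤ 1 := by
      refine (Measure.restrict_apply_le _ _).trans ?_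
      rw [withDensity_apply _ MeasurableSet.univ, Measure.restrict_univ, lintegral_componentENN]
    have hs : Measurable fun x => ENNReal.ofReal (√(p x)) := hp.measurable.sqrt.ennreal_ofReal
    have h := sq_lintegral_le_lintegral_sq hν hs.aemeasurable
    rw [restrict_withDensity hT.compl,
      lintegral_withDensity_eq_lintegral_mul _ (measurable_componentENN θ) hs,
      lintegral_withDensity_eq_lintegral_mul _ (measurable_componentENN θ) (hs.pow_const 2)] at h
    refine h.trans_eq (lintegral_congr fun x => ?_)
    simp only [Pi.mul_apply]
    rw [← ENNReal.ofReal_pow (Real.sqrt_nonneg _), Real.sq_sqrt (hp.nonneg x)]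
  refine (hp.weightENN_le_sq θ).trans ?_
  rw [← lintegral_add_compl _ hT]
  set I := ∫⁻ x in cube n M, componentENN θ x with hI
  refine (ENNReal.add_sq_le_two_mul _ _).trans ?_
  rw [mul_add]
  gcongr
  calc _ ≤ (ENNReal.ofReal (√M) * I) ^ 2 := pow_le_pow_left' h1 2
    _ = ENNReal.ofReal M * I * I := by
        rw [mul_pow, ← ENNReal.ofReal_pow (Real.sqrt_nonneg _), Real.sq_sqrt hM]
        ring
    _ ≤ ENNReal.ofReal M * ENNReal.ofReal (2 * M * Real.exp (-θ.2 i)) * I := by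
        gcongr
        exact lintegral_cube_componentENN_le θ i hM
    _ = _ := by rw [ENNReal.ofReal_mul hM]

/-- The weight at a wide scale has small mass, uniformly in the other scales. -/
theorem exists_lintegral_weightENN_le {ε : ENNReal} (hε : ε ≠ 0) :
    ∃ S : ℝ, ∀ (σ : Fin n → ℝ) (i : Fin n), S ≤ σ i → ∫⁻ μ, weightENN p (μ, σ) ≤ ε := by
  obtain ⟨M, hM0, hM⟩ := hp.exists_lintegral_compl_truncationSet_le (ε := ε / 4)
    (by simp [hε])
  have hlim : Tendsto (fun s : ℝ => 2 * (ENNReal.ofReal (M * (2 * M * Real.exp (-s))) *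
      volume (cube n M))) atTop (𝓝 0) := by
    have h1 : Tendsto (fun s : ℝ => M * (2 * M * Real.exp (-s))) atTop (𝓝 0) := by
      simpa using (Real.tendsto_exp_neg_atTop_nhds_zero.const_mul (2 * M)).const_mul M
    have h2 := ENNReal.Tendsto.const_mul (a := 2) (ENNReal.Tendsto.mul_const
      (ENNReal.tendsto_ofReal h1) (Or.inr (volume_cube_ne_top (n := n) M)))
      (Or.inr ENNReal.ofNat_ne_top)
    simpa using h2
  obtain ⟨S, hS⟩ := (ENNReal.tendsto_nhds_zero.1 hlim (ε / 2)
    (ENNReal.half_pos hε)).exists_forall_of_atTop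
  refine ⟨S, fun σ i hσ => ?_⟩
  refine (lintegral_mono fun μ => hp.weightENN_le_split (μ, σ) hM0 i).trans ?_
  have e1 := lintegral_componentENN_mul_swap σ (s := cube n M) (h := 1) measurable_one
  simp only [Pi.one_apply, mul_one, setLIntegral_one] at e1
  have e2 := lintegral_componentENN_mul_swap σ (s := (truncationSet p M)ᶜ) hp.measurable_ofReal
  have hm : Measurable fun μ => ∫⁻ x in cube n M, componentENN (μ, σ) x :=
    Measurable.lintegral_prod_right' (f := fun z : (Fin n → ℝ) × (Fin n → ℝ) =>
      componentENN (z.1, σ) z.2) (by fun_prop)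
  have hm' : Measurable fun μ => 2 * (ENNReal.ofReal (M * (2 * M * Real.exp (-σ i))) *
      ∫⁻ x in cube n M, componentENN (μ, σ) x) := (hm.const_mul _).const_mul _
  dsimp only
  rw [lintegral_add_left hm',
    lintegral_const_mul' _ _ ENNReal.ofNat_ne_top, lintegral_const_mul' _ _ ENNReal.ofReal_ne_top,
    e1, lintegral_const_mul' _ _ ENNReal.ofNat_ne_top, e2, ← ENNReal.add_halves ε]
  refine add_le_add (hS _ hσ) ?_
  calc 2 * ∫⁻ x in (truncationSet p M)ᶜ, ENNReal.ofReal (p x) ≤ 2 * (ε / 4) := by gcongr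
    _ = ε / 2 := by
        rw [show (4 : ENNReal) = 2 * 2 by norm_num, ENNReal.div_eq_inv_mul, ENNReal.mul_inv
          (by simp) (by simp), ← mul_assoc, ← mul_assoc, ENNReal.mul_inv_cancel (by simp) (by simp),
          one_mul, ENNReal.div_eq_inv_mul]

end IsLogIntegrableDensity
end Weight

/-! ### The Gibbs variational principle on bounded regions -/

/-- For `x > 0` the expression is `x * (t - 1 - log t)` at `t = y / x`. The terms `-x + y` have
integral zero for two probability densities and make the relative entropy integrand pointwise
nonnegative. -/
lemma relative_entropy_integrand {x y : ℝ} (hx : 0 ≤ x) (hy : 0 ≤ y) (hxy : y = 0 → x = 0) :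
    0 ≤ x * Real.log x - x * Real.log y - x + y ∧
      (x * Real.log x - x * Real.log y - x + y = 0 → x = y) := by
  rcases hx.eq_or_lt with rfl | hx
  · simp [hy, eq_comm]
  have hy' : 0 < y := lt_of_le_of_ne hy fun h => hx.ne' (hxy h.symm)
  have hdiv : 0 < y / x := div_pos hy' hx
  have e : x * (y / x) = y := by field_simp
  have hlog := Real.log_div hy'.ne' hx.ne'
  refine ⟨?_, fun h => ?_⟩
  · have h1 := mul_le_mul_of_nonneg_left (Real.log_le_sub_one_of_pos hdiv) hx.le
    rw [hlog] at h1
    linarith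
  · by_contra hne
    have h1 := mul_lt_mul_of_pos_left (Real.log_lt_sub_one_of_pos hdiv fun h1 =>
      hne ((div_eq_one_iff_eq hx.ne').1 h1).symm) hx
    rw [hlog] at h1
    linarith

section Gibbs
variable {n : ℕ}

lemma exists_bounds_of_isBounded {K : Set (Param n)} (hK : Bornology.IsBounded K) :
    ∃ R : ℝ, ∀ θ ∈ K, (∀ i, |θ.1 i| ≤ R) ∧ ∀ i, -R ≤ θ.2 i ∧ θ.2 i ≤ R := by
  obtain ⟨R, hR⟩ := hK.exists_norm_le
  refine ⟨R, fun θ hθ => ⟨fun i => ?_, fun i => abs_le.1 ?_⟩⟩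
  · exact (norm_le_pi_norm θ.1 i).trans ((norm_fst_le θ).trans (hR θ hθ))
  · exact (norm_le_pi_norm θ.2 i).trans ((norm_snd_le θ).trans (hR θ hθ))

lemma integrable_indicator_of_bounded {K : Set (Param n)} (hKm : MeasurableSet K)
    (hK : Bornology.IsBounded K) {f : Param n → ℝ} (hf : Measurable f) {B : ℝ}
    (hB : ∀ θ ∈ K, |f θ| ≤ B) : Integrable (K.indicator f) := by
  rw [integrable_indicator_iff hKm]
  exact Measure.integrableOn_of_bounded hK.measure_lt_top.ne hf.aestronglyMeasurable
    ((ae_restrict_iff' hKm).2 (ae_of_all _ hB))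

namespace IsLogIntegrableDensity

variable {p : (Fin n → ℝ) → ℝ} (hp : IsLogIntegrableDensity p)
include hp

lemma measurable_expect_log : Measurable fun θ : Param n => expect θ fun x => Real.log (p x) :=
  measurable_expect (Real.measurable_log.comp hp.measurable)

/-- One fixed component dominates, up to a constant, all those with parameters in a bounded set. -/
lemma exists_abs_expect_log_le {K : Set (Param n)} (hK : Bornology.IsBounded K) :
    ∃ B : ℝ, ∀ θ ∈ K, |expect θ fun x => Real.log (p x)| ≤ B := by
  obtain ⟨R, hR⟩ := exists_bounds_of_isBounded hK
  obtain ⟨C, hC, hle⟩ := component_le_of_bounds (n := n) R R R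
  refine ⟨∫ x, C * |component (0, widen fun _ => R) x * Real.log (p x)|, fun θ hθ => ?_⟩
  refine abs_integral_le_integral_abs.trans (integral_mono (hp.log θ).abs
    ((hp.log _).abs.const_mul C) fun x => ?_)
  simp only [abs_mul, abs_of_pos (component_pos _ _), ← mul_assoc]
  exact mul_le_mul_of_nonneg_right (hle θ x (hR θ hθ).1 (hR θ hθ).2) (abs_nonneg _)

/-- The affine factor covers three uses: the normaliser `(0, 1)`, the entropy `(1, -log N)` and the
potential `(1, c)`. -/
lemma integrable_indicator_negCEWeight_mul {K : Set (Param n)} (hKm : MeasurableSet K)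
    (hK : Bornology.IsBounded K) (a b : ℝ) :
    Integrable (K.indicator fun θ =>
      negCEWeight p θ * (a * (expect θ fun x => Real.log (p x)) + b)) := by
  obtain ⟨B, hB⟩ := hp.exists_abs_expect_log_le hK
  refine integrable_indicator_of_bounded hKm hK (B := Real.exp B * (|a| * B + |b|))
    (hp.measurable_negCEWeight.mul ((hp.measurable_expect_log.const_mul a).add_const b))
    fun θ hθ => ?_
  have h := hB θ hθ
  rw [abs_mul, abs_of_pos (negCEWeight_pos _ _)]
  have h1 : negCEWeight p θ ≤ Real.exp B := Real.exp_le_exp.2 ((le_abs_self _).trans h)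
  have h2 : |a * (expect θ fun x => Real.log (p x)) + b| ≤ |a| * B + |b| := by
    refine (abs_add_le _ _).trans ?_
    rw [abs_mul]
    gcongr
  exact mul_le_mul h1 h2 (abs_nonneg _) (Real.exp_pos _).le

lemma integrableOn_negCEWeight {K : Set (Param n)} (hKm : MeasurableSet K)
    (hK : Bornology.IsBounded K) : IntegrableOn (negCEWeight p) K := by
  have h := hp.integrable_indicator_negCEWeight_mul hKm hK 0 1
  rw [integrable_indicator_iff hKm] at h
  simpa using h

lemma setIntegral_negCEWeight_pos {K : Set (Param n)} (hKm : MeasurableSet K)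
    (hK : Bornology.IsBounded K) (hvol : volume K ≠ 0) : 0 < ∫ θ in K, negCEWeight p θ := by
  have : NeZero (volume.restrict K) := ⟨by rwa [Ne, Measure.restrict_eq_zero]⟩
  exact integral_exp_pos (hp.integrableOn_negCEWeight hKm hK)

variable {r : (Fin n → ℝ) → ℝ} {c : ℝ}
  (hr : ∀ θ : Param n, potential r 1 θ = (expect θ fun x => Real.log (p x)) + c)
include hr

lemma isMixingDensityOn_restrictedWeight {K : Set (Param n)} (hKm : MeasurableSet K)
    (hK : Bornology.IsBounded K) (hvol : volume K ≠ 0) :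
    IsMixingDensityOn r 1 K (restrictedWeight p K) := by
  have hN := hp.setIntegral_negCEWeight_pos hKm hK hvol
  have hint := hp.integrableOn_negCEWeight hKm hK
  unfold restrictedWeight
  set N := ∫ θ in K, negCEWeight p θ with hNdef
  have key := fun a b => (hp.integrable_indicator_negCEWeight_mul hKm hK a b).div_const N
  constructor
  · exact (hp.measurable_negCEWeight.div_const _).indicator hKm
  · exact fun θ => Set.indicator_nonneg (fun θ _ => div_nonneg (negCEWeight_pos _ _).le hN.le) θ
  · exact fun θ hθ => Set.indicator_of_notMem hθ _
  · exact (integrable_indicator_iff hKm).2 (hint.div_const N)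
  · rw [integral_indicator hKm, integral_div, ← hNdef, div_self hN.ne']
  · refine (key 1 (-Real.log N)).congr (ae_of_all _ fun θ => ?_)
    by_cases hθ : θ ∈ K
    · simp only [Set.indicator_of_mem hθ]
      rw [Real.log_div (negCEWeight_pos _ _).ne' hN.ne', negCEWeight, Real.log_exp]
      ring
    · simp [Set.indicator_of_notMem hθ]
  · refine (key 1 c).congr (ae_of_all _ fun θ => ?_)
    by_cases hθ : θ ∈ K
    · simp only [Set.indicator_of_mem hθ, hr]
      ring
    · simp [Set.indicator_of_notMem hθ]

/-- The objective is a constant minus the relative entropy with respect to the normalised weight. -/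
lemma objective_add_relative_entropy {K : Set (Param n)} (hKm : MeasurableSet K)
    (hK : Bornology.IsBounded K) (hvol : volume K ≠ 0) {ψ : Param n → ℝ}
    (hψ : IsMixingDensityOn r 1 K ψ) :
    Integrable (fun θ => ψ θ * Real.log (ψ θ) - ψ θ * Real.log (restrictedWeight p K θ) - ψ θ +
      restrictedWeight p K θ) ∧
    objective r ψ 1 + ∫ θ, (ψ θ * Real.log (ψ θ) - ψ θ * Real.log (restrictedWeight p K θ) - ψ θ +
      restrictedWeight p K θ) = Real.log (∫ θ in K, negCEWeight p θ) + c := by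
  have hN := hp.setIntegral_negCEWeight_pos hKm hK hvol
  have hR := hp.isMixingDensityOn_restrictedWeight hr hKm hK hvol
  set N := ∫ θ in K, negCEWeight p θ with hNdef
  -- On `K` the logarithm of the normalised weight is the potential minus `log N + c`. Off `K` the
  -- factor `ψ θ = 0` makes the value of `log 0` irrelevant.
  have e : ∀ θ, ψ θ * Real.log (restrictedWeight p K θ) =
      ψ θ * potential r 1 θ - (Real.log N + c) * ψ θ := fun θ => by
    by_cases hθ : θ ∈ K
    · rw [restrictedWeight, Set.indicator_of_mem hθ, ← hNdef,
        Real.log_div (negCEWeight_pos _ _).ne' hN.ne', negCEWeight, Real.log_exp, hr]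
      ring
    · rw [hψ.zero_off θ hθ]
      ring
  have i2 : Integrable fun θ => ψ θ * Real.log (restrictedWeight p K θ) := by
    simp_rw [e]
    exact hψ.integrable_potential.sub (hψ.integrable.const_mul _)
  have i12 : Integrable fun θ => ψ θ * Real.log (ψ θ) -
      ψ θ * Real.log (restrictedWeight p K θ) := hψ.integrable_entropy.sub i2
  have i123 : Integrable fun θ => ψ θ * Real.log (ψ θ) -
      ψ θ * Real.log (restrictedWeight p K θ) - ψ θ := i12.sub hψ.integrable
  refine ⟨i123.add hR.integrable, ?_⟩
  rw [integral_add i123 hR.integrable, integral_sub i12 hψ.integrable,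
    integral_sub hψ.integrable_entropy i2, hR.integral_eq_one, hψ.integral_eq_one]
  simp_rw [e]
  rw [integral_sub hψ.integrable_potential (hψ.integrable.const_mul _), integral_const_mul,
    hψ.integral_eq_one, objective, mixEntropy]
  ring

lemma relative_entropy_nonneg {K : Set (Param n)} (hKm : MeasurableSet K)
    (hK : Bornology.IsBounded K) (hvol : volume K ≠ 0) {ψ : Param n → ℝ}
    (hψ : IsMixingDensityOn r 1 K ψ) (θ : Param n) :
    0 ≤ ψ θ * Real.log (ψ θ) - ψ θ * Real.log (restrictedWeight p K θ) - ψ θ +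
      restrictedWeight p K θ ∧
    (ψ θ * Real.log (ψ θ) - ψ θ * Real.log (restrictedWeight p K θ) - ψ θ +
      restrictedWeight p K θ = 0 → ψ θ = restrictedWeight p K θ) := by
  have hR := hp.isMixingDensityOn_restrictedWeight hr hKm hK hvol
  refine relative_entropy_integrand (hψ.nonneg θ) (hR.nonneg θ) fun h0 => hψ.zero_off θ fun hθ => ?_
  rw [restrictedWeight, Set.indicator_of_mem hθ] at h0
  exact (div_pos (negCEWeight_pos p θ) (hp.setIntegral_negCEWeight_pos hKm hK hvol)).ne' h0

/-- On a bounded region the normalised weight is the unique maximiser of the objective. -/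
theorem isOptimalOn_restrictedWeight {K : Set (Param n)} (hKm : MeasurableSet K)
    (hK : Bornology.IsBounded K) (hvol : volume K ≠ 0) :
    IsOptimalOn r 1 K (restrictedWeight p K) ∧
      ∀ ψ, IsOptimalOn r 1 K ψ → ψ =ᵐ[volume] restrictedWeight p K := by
  have hR := hp.isMixingDensityOn_restrictedWeight hr hKm hK hvol
  have hRobj := (hp.objective_add_relative_entropy hr hKm hK hvol hR).2
  simp only [sub_self, zero_sub, neg_add_cancel, integral_zero, add_zero] at hRobj
  refine ⟨⟨hR, fun φ hφ => ?_⟩, fun ψ hψ => ?_⟩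
  · have h := (hp.objective_add_relative_entropy hr hKm hK hvol hφ).2
    have h0 := integral_nonneg_of_ae (μ := volume) (ae_of_all _
      fun θ => (hp.relative_entropy_nonneg hr hKm hK hvol hφ θ).1)
    linarith
  · obtain ⟨hi, h⟩ := hp.objective_add_relative_entropy hr hKm hK hvol hψ.1
    have hnn := fun θ => (hp.relative_entropy_nonneg hr hKm hK hvol hψ.1 θ).1
    have h1 := hψ.2 _ hR
    -- Optimality of `ψ` forces its relative entropy to be at most zero, so the nonnegative
    -- integrand vanishes almost everywhere.
    have h0 := (integral_eq_zero_iff_of_nonneg hnn hi).1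
      (le_antisymm (by linarith) (integral_nonneg hnn))
    filter_upwards [h0] with θ hθ
    exact (hp.relative_entropy_nonneg hr hKm hK hvol hψ.1 θ).2 hθ

end IsLogIntegrableDensity

/-! ### The weight is improper -/

lemma ENNReal.half_le_of_one_le_add {a d : ENNReal} (h : 1 ≤ a + d) (hd : d ≤ 2⁻¹) : 2⁻¹ ≤ a := by
  rw [← ENNReal.one_sub_inv_two, tsub_le_iff_right]
  exact h.trans (add_le_add le_rfl hd)

/-- Below some `S` every fibre has mass at least one half, and `Set.Iic S` has infinite volume
because `n > 0`. -/
theorem IsLogIntegrableDensity.lintegral_weightENN_eq_top {p : (Fin n → ℝ) → ℝ}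
    (hp : IsLogIntegrableDensity p) (hn : 0 < n) : ∫⁻ θ : Param n, weightENN p θ = ⊤ := by
  have hhalf : (2⁻¹ : ENNReal) ≠ 0 := by simp
  obtain ⟨S, hS⟩ := (ENNReal.tendsto_nhds_zero.1 hp.tendsto_deficit 2⁻¹
    (pos_iff_ne_zero.2 hhalf)).exists_forall_of_atBot
  have hge : ∀ σ ≤ S, 2⁻¹ ≤ ∫⁻ μ, weightENN p (μ, σ) := fun σ hσ => by
    have h1 : (1 : ENNReal) ≤ (∫⁻ μ, weightENN p (μ, σ)) + deficit p σ := by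
      rw [deficit, ← lintegral_add_left (hp.measurable_weightENN_mean σ), ← hp.lintegral_eq_one]
      exact lintegral_mono fun μ => le_add_tsub
    exact ENNReal.half_le_of_one_le_add h1 (hS σ hσ)
  have hvol : volume (Set.Iic S) = ⊤ := by
    have : Nonempty (Fin n) := ⟨⟨0, hn⟩⟩
    rw [← Set.pi_univ_Iic, volume_pi_pi]
    simp [Real.volume_Iic, hn.ne']
  rw [Measure.volume_eq_prod, lintegral_prod_symm' _ hp.measurable_weightENN]
  refine top_le_iff.1 ?_
  calc (⊤ : ENNReal) = 2⁻¹ * volume (Set.Iic S) := by rw [hvol, ENNReal.mul_top hhalf]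
    _ = ∫⁻ σ in Set.Iic S, 2⁻¹ := (setLIntegral_const _ _).symm
    _ ≤ ∫⁻ σ in Set.Iic S, ∫⁻ μ, weightENN p (μ, σ) :=
        setLIntegral_mono' measurableSet_Iic hge
    _ ≤ _ := setLIntegral_le_lintegral _ _

end Gibbs

/-- Convexity of `y ↦ (X - y)⁺`: the deficit of an average is at most the average deficit. -/
lemma tsub_lintegral_mul_le {α : Type*} [MeasurableSpace α] {μ : Measure α} {ρ F : α → ENNReal}
    (hρ : Measurable ρ) (hF : Measurable F) (h1 : ∫⁻ x, ρ x ∂μ = 1) (X : ENNReal) :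
    X - ∫⁻ x, ρ x * F x ∂μ ≤ ∫⁻ x, ρ x * (X - F x) ∂μ := by
  have hm : Measurable fun x => ρ x * F x := hρ.mul hF
  rw [tsub_le_iff_left, ← lintegral_add_left hm]
  calc X = ∫⁻ x, ρ x * X ∂μ := by rw [lintegral_mul_const _ hρ, h1, one_mul]
    _ ≤ _ := lintegral_mono fun x => by
      dsimp only
      rw [← mul_add]
      gcongr
      exact le_add_tsub

section Marginal
variable {n : ℕ}

/-! ### Parameter boxes -/

lemma paramBox_eq_prod (a s b : ℝ) :
    paramBox n a s b = cube n a ×ˢ Set.Icc (fun _ => -s) (fun _ => b) := by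
  ext θ
  simp only [paramBox, Set.mem_ofPred_eq, Set.mem_prod, mem_cube, Set.mem_Icc, Pi.le_def,
    forall_and]

lemma measurableSet_paramBox (a s b : ℝ) : MeasurableSet (paramBox n a s b) := by
  rw [paramBox_eq_prod]
  exact (measurableSet_cube a).prod measurableSet_Icc

lemma isBounded_paramBox (a s b : ℝ) : Bornology.IsBounded (paramBox n a s b) := by
  rw [paramBox_eq_prod]
  exact ((isCompact_cube a).prod isCompact_Icc).isBounded

/-- The density of the log-scales under a mixing density. -/
def scaleMarginal (ψ : Param n → ℝ) (σ : Fin n → ℝ) : ENNReal :=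
  ∫⁻ μ, ENNReal.ofReal (ψ (μ, σ))

/-! ### Marginals and mixtures of a mixing density. -/

namespace IsMixingDensityOn

variable {r : (Fin n → ℝ) → ℝ} {lam : ℝ} {K : Set (Param n)} {ψ : Param n → ℝ}
  (hψ : IsMixingDensityOn r lam K ψ)
include hψ

lemma measurable_ofReal : Measurable fun θ => ENNReal.ofReal (ψ θ) := hψ.measurable.ennreal_ofReal

lemma lintegral_eq_one : ∫⁻ θ, ENNReal.ofReal (ψ θ) = 1 := by
  rw [← ofReal_integral_eq_lintegral_ofReal hψ.integrable (ae_of_all _ hψ.nonneg),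
    hψ.integral_eq_one, ENNReal.ofReal_one]

lemma isProbabilityMeasure_mixingLaw : IsProbabilityMeasure (mixingLaw ψ) :=
  ⟨by rw [mixingLaw, withDensity_apply _ MeasurableSet.univ, Measure.restrict_univ,
    hψ.lintegral_eq_one]⟩

/-- The boxes may be degenerate for small `k`; positive volume is recovered from the existence of an
admissible density. -/
lemma volume_ne_zero : volume K ≠ 0 := by
  intro h0
  have h1 : ψ =ᵐ[volume] 0 := by
    filter_upwards [measure_eq_zero_iff_ae_notMem.1 h0] with θ hθ using hψ.zero_off θ hθ
  have h2 := hψ.integral_eq_one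
  rw [integral_congr_ae h1] at h2
  simp at h2

lemma measurable_scaleMarginal : Measurable (scaleMarginal ψ) :=
  Measurable.lintegral_prod_left' hψ.measurable_ofReal

lemma lintegral_scaleMarginal : ∫⁻ σ, scaleMarginal ψ σ = 1 := by
  rw [← hψ.lintegral_eq_one, Measure.volume_eq_prod, lintegral_prod_symm' _ hψ.measurable_ofReal]
  rfl

lemma mixingLaw_snd {A : Set (Fin n → ℝ)} (hA : MeasurableSet A) :
    mixingLaw ψ {θ | θ.2 ∈ A} = ∫⁻ σ in A, scaleMarginal ψ σ := by
  have hm : MeasurableSet {θ : Param n | θ.2 ∈ A} := measurable_snd hA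
  rw [mixingLaw, withDensity_apply _ hm, ← lintegral_indicator hm, ← lintegral_indicator hA,
    Measure.volume_eq_prod, lintegral_prod_symm' _ (hψ.measurable_ofReal.indicator hm)]
  refine lintegral_congr fun σ => ?_
  by_cases hσ : σ ∈ A <;> simp [hσ, Set.indicator, scaleMarginal]

lemma integral_snd_eq : ∀ᵐ μ : Fin n → ℝ, ENNReal.ofReal (∫ σ, ψ (μ, σ)) =
    ∫⁻ σ, ENNReal.ofReal (ψ (μ, σ)) := by
  have h := hψ.integrable
  rw [Measure.volume_eq_prod] at h
  filter_upwards [h.prod_right_ae] with μ hμ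
  exact ofReal_integral_eq_lintegral_ofReal hμ (ae_of_all _ fun σ => hψ.nonneg _)

lemma lintegral_integral_snd : ∫⁻ μ : Fin n → ℝ, ENNReal.ofReal (∫ σ, ψ (μ, σ)) = 1 := by
  rw [lintegral_congr_ae hψ.integral_snd_eq, ← hψ.lintegral_eq_one, Measure.volume_eq_prod,
    lintegral_prod _ hψ.measurable_ofReal.aemeasurable]

lemma measurable_integral_snd : Measurable fun μ : Fin n → ℝ => ∫ σ, ψ (μ, σ) :=
  (StronglyMeasurable.integral_prod_right' hψ.measurable.stronglyMeasurable).measurable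

end IsMixingDensityOn

section Box

variable {r : (Fin n → ℝ) → ℝ} {lam a s b : ℝ} {ψ : Param n → ℝ}

lemma component_le_of_mem_paramBox {θ : Param n} (hθ : θ ∈ paramBox n a s b) (x : Fin n → ℝ) :
    component θ x ≤ Real.exp s ^ n := by
  refine (component_le_exp_neg _ _).trans ?_
  rw [show Real.exp s ^ n = ∏ _i : Fin n, Real.exp s by simp]
  refine Finset.prod_le_prod (fun i _ => (Real.exp_pos _).le) fun i _ => Real.exp_le_exp.2 ?_
  linarith [(hθ i).2.1]

namespace IsMixingDensityOn

variable (hψ : IsMixingDensityOn r lam (paramBox n a s b) ψ)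
include hψ

lemma integrable_component_mul (x : Fin n → ℝ) : Integrable fun θ => component θ x * ψ θ := by
  refine (hψ.integrable.const_mul (Real.exp s ^ n)).mono'
    ((measurable_component_left x).mul hψ.measurable).aestronglyMeasurable (ae_of_all _ fun θ => ?_)
  rw [Real.norm_of_nonneg (mul_nonneg (component_pos _ _).le (hψ.nonneg θ))]
  by_cases hθ : θ ∈ paramBox n a s b
  · exact mul_le_mul_of_nonneg_right (component_le_of_mem_paramBox hθ x) (hψ.nonneg θ)
  · simp [hψ.zero_off θ hθ]

lemma ofReal_mixture (x : Fin n → ℝ) :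
    ENNReal.ofReal (mixture ψ x) = ∫⁻ θ, componentENN θ x * ENNReal.ofReal (ψ θ) := by
  rw [mixture, ofReal_integral_eq_lintegral_ofReal (hψ.integrable_component_mul x)
    (ae_of_all _ fun θ => mul_nonneg (component_pos _ _).le (hψ.nonneg θ))]
  exact lintegral_congr fun θ => by rw [componentENN, ENNReal.ofReal_mul (component_pos _ _).le]

lemma mixture_nonneg (x : Fin n → ℝ) : 0 ≤ mixture ψ x :=
  integral_nonneg fun θ => mul_nonneg (component_pos _ _).le (hψ.nonneg θ)

lemma measurable_mixture : Measurable (mixture ψ) := by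
  have h : Measurable (Function.uncurry fun (x : Fin n → ℝ) (θ : Param n) =>
      component θ x * ψ θ) :=
    (measurable_snd.component measurable_fst).mul (hψ.measurable.comp measurable_snd)
  exact h.stronglyMeasurable.integral_prod_right.measurable

lemma lintegral_mixture : ∫⁻ x, ENNReal.ofReal (mixture ψ x) = 1 := by
  simp_rw [hψ.ofReal_mixture]
  have h : Measurable (Function.uncurry fun (x : Fin n → ℝ) (θ : Param n) =>
      componentENN θ x * ENNReal.ofReal (ψ θ)) :=
    (measurable_snd.componentENN measurable_fst).mul (hψ.measurable_ofReal.comp measurable_snd)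
  rw [lintegral_lintegral_swap h.aemeasurable, ← hψ.lintegral_eq_one]
  refine lintegral_congr fun θ => ?_
  rw [lintegral_mul_const _ (measurable_componentENN θ), lintegral_componentENN, one_mul]

end IsMixingDensityOn

end Box

/-! ### The normalised weight on a box -/

/-- The weight at scale `σ`, cut off outside the cube `[-a, a]ⁿ` of means. -/
def cutWeight (p : (Fin n → ℝ) → ℝ) (a : ℝ) (σ μ : Fin n → ℝ) : ENNReal :=
  (cube n a).indicator (fun μ => weightENN p (μ, σ)) μ

/-- The mass of `p` which is not covered by the cut-off weight. -/
def cutDeficit (p : (Fin n → ℝ) → ℝ) (a : ℝ) (σ : Fin n → ℝ) : ENNReal :=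
  ∫⁻ μ, (ENNReal.ofReal (p μ) - cutWeight p a σ μ)

namespace IsLogIntegrableDensity

variable {p : (Fin n → ℝ) → ℝ} (hp : IsLogIntegrableDensity p)
include hp

lemma measurable_cutWeight (a : ℝ) {α : Type*} [MeasurableSpace α] {f g : α → Fin n → ℝ}
    (hf : Measurable f) (hg : Measurable g) : Measurable fun z => cutWeight p a (f z) (g z) := by
  have h : (fun z => cutWeight p a (f z) (g z)) =
      (g ⁻¹' cube n a).indicator fun z => weightENN p (g z, f z) := by
    ext z
    by_cases hz : g z ∈ cube n a <;> simp [cutWeight, Set.indicator, hz]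
  have hw : Measurable fun z => weightENN p (g z, f z) :=
    hp.measurable_weightENN.comp (hg.prodMk hf)
  rw [h]
  exact hw.indicator (hg (measurableSet_cube a))

lemma measurable_ofReal_sub_cutWeight (a : ℝ) :
    Measurable fun z : (Fin n → ℝ) × (Fin n → ℝ) =>
      ENNReal.ofReal (p z.1) - cutWeight p a z.2 z.1 :=
  (hp.measurable_ofReal.comp measurable_fst).sub
    (hp.measurable_cutWeight a measurable_snd measurable_fst)

lemma lintegral_cutWeight_le_one (a : ℝ) (σ : Fin n → ℝ) : ∫⁻ μ, cutWeight p a σ μ ≤ 1 :=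
  (lintegral_mono fun _ => Set.indicator_le_self _ _ _).trans (hp.lintegral_weightENN_le_one σ)

lemma cutDeficit_le (a : ℝ) (σ : Fin n → ℝ) :
    cutDeficit p a σ ≤ deficit p σ + ∫⁻ x in (cube n a)ᶜ, ENNReal.ofReal (p x) := by
  rw [cutDeficit, deficit, ← lintegral_indicator (measurableSet_cube a).compl,
    ← lintegral_add_right _ (hp.measurable_ofReal.indicator (measurableSet_cube a).compl)]
  refine lintegral_mono fun μ => ?_
  by_cases hμ : μ ∈ cube n a
  · simp [cutWeight, hμ]
  · simp [cutWeight, hμ]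

/-- Smoothing the cut-off weight with the components at the same scale loses little mass. -/
lemma lintegral_sub_smooth_cutWeight_le (a : ℝ) (σ : Fin n → ℝ) :
    ∫⁻ x, (ENNReal.ofReal (p x) - ∫⁻ μ, componentENN (μ, σ) x * cutWeight p a σ μ) ≤
      deficit p σ + cutDeficit p a σ := by
  have hcw : Measurable (cutWeight p a σ) :=
    hp.measurable_cutWeight a measurable_const measurable_id
  have hd : Measurable fun μ => ENNReal.ofReal (p μ) - cutWeight p a σ μ :=
    hp.measurable_ofReal.sub hcw
  have hdw : Measurable fun μ => ENNReal.ofReal (p μ) - weightENN p (μ, σ) :=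
    hp.measurable_ofReal.sub (hp.measurable_weightENN_mean σ)
  -- Write `p ≤ (p - w) + w`, bound `w` by the smoothing of `p` through Jensen, and split that `p`
  -- into cut-off weight and cut-off deficit. Integrating in `x` preserves the mass of the smoothed
  -- deficit.
  have hpt : ∀ x, ENNReal.ofReal (p x) - ∫⁻ μ, componentENN (μ, σ) x * cutWeight p a σ μ ≤
      (ENNReal.ofReal (p x) - weightENN p (x, σ)) +
        ∫⁻ μ, componentENN (x, σ) μ * (ENNReal.ofReal (p μ) - cutWeight p a σ μ) := by
    intro x
    simp_rw [fun μ => componentENN_swap μ σ x]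
    rw [tsub_le_iff_right]
    calc ENNReal.ofReal (p x)
        ≤ (ENNReal.ofReal (p x) - weightENN p (x, σ)) + weightENN p (x, σ) := le_tsub_add
      _ ≤ (ENNReal.ofReal (p x) - weightENN p (x, σ)) +
          ∫⁻ μ, (componentENN (x, σ) μ * (ENNReal.ofReal (p μ) - cutWeight p a σ μ) +
            componentENN (x, σ) μ * cutWeight p a σ μ) := by
          gcongr
          refine (hp.weightENN_le (x, σ)).trans (lintegral_mono fun μ => ?_)
          dsimp only
          rw [← mul_add]
          gcongr
          exact le_tsub_add
      _ = _ := by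
          have hm : Measurable fun μ =>
              componentENN (x, σ) μ * (ENNReal.ofReal (p μ) - cutWeight p a σ μ) :=
            (measurable_componentENN _).mul hd
          rw [lintegral_add_left hm, add_assoc]
  refine (lintegral_mono hpt).trans ?_
  rw [lintegral_add_left hdw]
  refine add_le_add le_rfl (le_of_eq ?_)
  have h := lintegral_componentENN_mul_swap σ (s := Set.univ) hd
  simpa only [Measure.restrict_univ, cutDeficit] using h

section

variable {a s b : ℝ} (hvol : volume (paramBox n a s b) ≠ 0)
include hvol

lemma ofReal_restrictedWeight (θ : Param n) :
    ENNReal.ofReal (restrictedWeight p (paramBox n a s b) θ) =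
      (paramBox n a s b).indicator
        (fun θ => (∫⁻ θ in paramBox n a s b, weightENN p θ)⁻¹ * weightENN p θ) θ := by
  have hN := hp.setIntegral_negCEWeight_pos (measurableSet_paramBox a s b)
    (isBounded_paramBox a s b) hvol
  have hint := hp.integrableOn_negCEWeight (measurableSet_paramBox a s b) (isBounded_paramBox a s b)
  by_cases hθ : θ ∈ paramBox n a s b
  · rw [restrictedWeight, Set.indicator_of_mem hθ, Set.indicator_of_mem hθ,
      ENNReal.ofReal_div_of_pos hN, ofReal_integral_eq_lintegral_ofReal hint
        (ae_of_all _ fun θ => (negCEWeight_pos p θ).le), ENNReal.div_eq_inv_mul]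
    rfl
  · rw [restrictedWeight, Set.indicator_of_notMem hθ, Set.indicator_of_notMem hθ,
      ENNReal.ofReal_zero]

lemma ofReal_restrictedWeight_mk (μ σ : Fin n → ℝ) :
    ENNReal.ofReal (restrictedWeight p (paramBox n a s b) (μ, σ)) =
      (Set.Icc (fun _ => -s) (fun _ => b)).indicator
        (fun σ => (∫⁻ θ in paramBox n a s b, weightENN p θ)⁻¹ * cutWeight p a σ μ) σ := by
  rw [hp.ofReal_restrictedWeight hvol, paramBox_eq_prod]
  by_cases hσ : σ ∈ Set.Icc (fun _ : Fin n => -s) (fun _ => b)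
  · by_cases hμ : μ ∈ cube n a
    · rw [Set.indicator_of_mem (Set.mk_mem_prod hμ hσ), Set.indicator_of_mem hσ, cutWeight,
        Set.indicator_of_mem hμ]
    · rw [Set.indicator_of_notMem (fun h => hμ h.1), Set.indicator_of_mem hσ, cutWeight,
        Set.indicator_of_notMem hμ, mul_zero]
  · rw [Set.indicator_of_notMem (fun h => hσ h.2), Set.indicator_of_notMem hσ]

lemma scaleMarginal_restrictedWeight (σ : Fin n → ℝ) :
    scaleMarginal (restrictedWeight p (paramBox n a s b)) σ =
      (Set.Icc (fun _ => -s) (fun _ => b)).indicator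
        (fun σ => (∫⁻ θ in paramBox n a s b, weightENN p θ)⁻¹ * ∫⁻ μ, cutWeight p a σ μ) σ := by
  simp only [scaleMarginal, hp.ofReal_restrictedWeight_mk hvol]
  by_cases hσ : σ ∈ Set.Icc (fun _ : Fin n => -s) (fun _ => b)
  · simp only [Set.indicator_of_mem hσ]
    exact lintegral_const_mul _ (hp.measurable_cutWeight a measurable_const measurable_id)
  · simp [Set.indicator_of_notMem hσ]

/-- On the box the density is `N⁻¹` times the cut-off weight, while the scale marginal is `N⁻¹`
times a fibre mass at most one. The lower bound no longer contains the normaliser and averages with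
the probability density of the scales. -/
lemma scaleMarginal_mul_cutWeight_le (μ σ : Fin n → ℝ) :
    scaleMarginal (restrictedWeight p (paramBox n a s b)) σ * cutWeight p a σ μ ≤
      ENNReal.ofReal (restrictedWeight p (paramBox n a s b) (μ, σ)) := by
  rw [hp.scaleMarginal_restrictedWeight hvol, hp.ofReal_restrictedWeight_mk hvol]
  by_cases hσ : σ ∈ Set.Icc (fun _ : Fin n => -s) (fun _ => b)
  · simp only [Set.indicator_of_mem hσ]
    gcongr
    exact mul_le_of_le_one_right zero_le (hp.lintegral_cutWeight_le_one a σ)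
  · simp [Set.indicator_of_notMem hσ]

end

variable {a s b : ℝ} {r : (Fin n → ℝ) → ℝ} {lam : ℝ}
  (hψ : IsMixingDensityOn r lam (paramBox n a s b) (restrictedWeight p (paramBox n a s b)))
include hψ

lemma lintegral_scaleMarginal_mul_cutDeficit_le :
    ∫⁻ σ, scaleMarginal (restrictedWeight p (paramBox n a s b)) σ * cutDeficit p a σ ≤
      (∫⁻ σ, scaleMarginal (restrictedWeight p (paramBox n a s b)) σ * deficit p σ) +
        ∫⁻ x in (cube n a)ᶜ, ENNReal.ofReal (p x) := by
  set T := ∫⁻ x in (cube n a)ᶜ, ENNReal.ofReal (p x)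
  set ρ := scaleMarginal (restrictedWeight p (paramBox n a s b))
  have hρ : Measurable ρ := hψ.measurable_scaleMarginal
  have hρd : Measurable fun σ => ρ σ * deficit p σ := hρ.mul hp.measurable_deficit
  calc ∫⁻ σ, ρ σ * cutDeficit p a σ ≤ ∫⁻ σ, (ρ σ * deficit p σ + ρ σ * T) :=
        lintegral_mono fun σ => by
          dsimp only
          rw [← mul_add]
          gcongr
          exact hp.cutDeficit_le a σ
    _ = _ := by
        rw [lintegral_add_left hρd, lintegral_mul_const _ hρ,
          hψ.lintegral_scaleMarginal, one_mul]

/-- The mean marginal dominates the average of the cut-off weights over the scale law, so its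
deficit is at most the average of their deficits. -/
lemma lintegral_means_le :
    ∫⁻ μ, ‖(∫ σ, restrictedWeight p (paramBox n a s b) (μ, σ)) - p μ‖ₑ ≤
      2 * ((∫⁻ σ, scaleMarginal (restrictedWeight p (paramBox n a s b)) σ * deficit p σ) +
        ∫⁻ x in (cube n a)ᶜ, ENNReal.ofReal (p x)) := by
  set ψ := restrictedWeight p (paramBox n a s b) with hψdef
  have hρ := hψ.measurable_scaleMarginal
  refine (lintegral_enorm_sub_le hψ.measurable_integral_snd.aemeasurable
    hp.measurable.aemeasurable (fun μ => integral_nonneg fun σ => hψ.nonneg _) hp.nonneg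
    (by rw [hψ.lintegral_integral_snd, hp.lintegral_eq_one]) (by simp [hp.lintegral_eq_one])).trans
    (mul_le_mul_right ?_ 2)
  refine le_trans ?_ (hp.lintegral_scaleMarginal_mul_cutDeficit_le hψ)
  have hmz : Measurable (Function.uncurry fun μ σ : Fin n → ℝ =>
      scaleMarginal ψ σ * (ENNReal.ofReal (p μ) - cutWeight p a σ μ)) :=
    (hρ.comp measurable_snd).mul (hp.measurable_ofReal_sub_cutWeight a)
  calc ∫⁻ μ, (ENNReal.ofReal (p μ) - ENNReal.ofReal (∫ σ, ψ (μ, σ)))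
      ≤ ∫⁻ μ, ∫⁻ σ, scaleMarginal ψ σ * (ENNReal.ofReal (p μ) - cutWeight p a σ μ) := by
        refine lintegral_mono_ae ?_
        filter_upwards [hψ.integral_snd_eq] with μ hμ
        rw [hμ]
        refine le_trans (tsub_le_tsub_left (lintegral_mono fun σ =>
          hp.scaleMarginal_mul_cutWeight_le hψ.volume_ne_zero μ σ) _) ?_
        exact tsub_lintegral_mul_le hρ
          (hp.measurable_cutWeight a measurable_id measurable_const)
          hψ.lintegral_scaleMarginal _
    _ = ∫⁻ σ, ∫⁻ μ, scaleMarginal ψ σ * (ENNReal.ofReal (p μ) - cutWeight p a σ μ) :=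
        lintegral_lintegral_swap hmz.aemeasurable
    _ = ∫⁻ σ, scaleMarginal ψ σ * cutDeficit p a σ := by
        refine lintegral_congr fun σ => ?_
        have hm : Measurable fun μ => ENNReal.ofReal (p μ) - cutWeight p a σ μ :=
          hp.measurable_ofReal.sub (hp.measurable_cutWeight a measurable_const measurable_id)
        exact lintegral_const_mul _ hm

/-- As for the means, with the cut-off weights smoothed at their own scale. Smoothing costs one
further `deficit`, whence the inner factor `2`. -/
lemma lintegral_mixture_le :
    ∫⁻ x, ‖mixture (restrictedWeight p (paramBox n a s b)) x - p x‖ₑ ≤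
      2 * (2 * (∫⁻ σ, scaleMarginal (restrictedWeight p (paramBox n a s b)) σ * deficit p σ) +
        ∫⁻ x in (cube n a)ᶜ, ENNReal.ofReal (p x)) := by
  set ψ := restrictedWeight p (paramBox n a s b) with hψdef
  have hρ := hψ.measurable_scaleMarginal
  refine (lintegral_enorm_sub_le hψ.measurable_mixture.aemeasurable
    hp.measurable.aemeasurable hψ.mixture_nonneg hp.nonneg
    (by rw [hψ.lintegral_mixture, hp.lintegral_eq_one]) (by simp [hp.lintegral_eq_one])).trans
    (mul_le_mul_right ?_ 2)
  set H : (Fin n → ℝ) → (Fin n → ℝ) → ENNReal := fun x σ =>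
    ∫⁻ μ, componentENN (μ, σ) x * cutWeight p a σ μ with hH
  have hρd : Measurable fun σ => scaleMarginal ψ σ * deficit p σ := hρ.mul hp.measurable_deficit
  have hHm : Measurable fun z : (Fin n → ℝ) × (Fin n → ℝ) => H z.1 z.2 := by
    have h : Measurable fun z : ((Fin n → ℝ) × (Fin n → ℝ)) × (Fin n → ℝ) =>
        componentENN (z.2, z.1.2) z.1.1 * cutWeight p a z.1.2 z.2 := by
      refine Measurable.mul (by fun_prop) ?_
      exact hp.measurable_cutWeight a (measurable_snd.comp measurable_fst) measurable_snd
    exact h.lintegral_prod_right'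
  have hHx : ∀ x, Measurable fun σ => H x σ := fun x => by
    have h := hHm.comp (measurable_prodMk_left (x := x))
    simpa only [Function.comp_def] using h
  have hHσ : ∀ σ, Measurable fun x => H x σ := fun σ => by
    have h := hHm.comp (measurable_prodMk_right (y := σ))
    simpa only [Function.comp_def] using h
  have hmz : Measurable (Function.uncurry fun x σ : Fin n → ℝ =>
      scaleMarginal ψ σ * (ENNReal.ofReal (p x) - H x σ)) :=
    (hρ.comp measurable_snd).mul ((hp.measurable_ofReal.comp measurable_fst).sub hHm)
  calc ∫⁻ x, (ENNReal.ofReal (p x) - ENNReal.ofReal (mixture ψ x))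
      ≤ ∫⁻ x, ∫⁻ σ, scaleMarginal ψ σ * (ENNReal.ofReal (p x) - H x σ) := by
        refine lintegral_mono fun x => ?_
        have hm : Measurable fun θ : Param n => componentENN θ x * ENNReal.ofReal (ψ θ) :=
          (measurable_componentENN_left x).mul hψ.measurable_ofReal
        rw [hψ.ofReal_mixture, Measure.volume_eq_prod, lintegral_prod_symm' _ hm]
        refine le_trans (tsub_le_tsub_left (lintegral_mono fun σ => ?_) _)
          (tsub_lintegral_mul_le hρ (hHx x) hψ.lintegral_scaleMarginal _)
        have hcm : Measurable fun μ => componentENN (μ, σ) x * cutWeight p a σ μ :=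
          Measurable.mul (by fun_prop)
            (hp.measurable_cutWeight a measurable_const measurable_id)
        simp only [hH]
        rw [← lintegral_const_mul _ hcm]
        refine lintegral_mono fun μ => ?_
        dsimp only
        rw [mul_left_comm]
        gcongr
        exact hp.scaleMarginal_mul_cutWeight_le hψ.volume_ne_zero μ σ
    _ = ∫⁻ σ, ∫⁻ x, scaleMarginal ψ σ * (ENNReal.ofReal (p x) - H x σ) :=
        lintegral_lintegral_swap hmz.aemeasurable
    _ ≤ ∫⁻ σ, (scaleMarginal ψ σ * deficit p σ + scaleMarginal ψ σ * cutDeficit p a σ) := by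
        refine lintegral_mono fun σ => ?_
        dsimp only
        have hm : Measurable fun x => ENNReal.ofReal (p x) - H x σ :=
          hp.measurable_ofReal.sub (hHσ σ)
        rw [lintegral_const_mul _ hm, ← mul_add]
        gcongr
        exact hp.lintegral_sub_smooth_cutWeight_le a σ
    _ = (∫⁻ σ, scaleMarginal ψ σ * deficit p σ) +
          ∫⁻ σ, scaleMarginal ψ σ * cutDeficit p a σ :=
        lintegral_add_left hρd _
    _ ≤ _ := by
        rw [two_mul, add_assoc]
        exact add_le_add le_rfl (hp.lintegral_scaleMarginal_mul_cutDeficit_le hψ)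

end IsLogIntegrableDensity
end Marginal

section Narrow
variable {n : ℕ}

/-! ### Concentration on narrow scales -/

lemma volume_slab (i : Fin n) (s b L S : ℝ) :
    volume (Set.Icc (Function.update (fun _ : Fin n => -s) i L)
      (Function.update (fun _ => b) i S)) =
      ENNReal.ofReal (S - L) * ENNReal.ofReal (b + s) ^ (n - 1) := by
  have h : (fun j => ENNReal.ofReal (Function.update (fun _ : Fin n => b) i S j -
      Function.update (fun _ => -s) i L j)) =
      Function.update (fun _ => ENNReal.ofReal (b + s)) i (ENNReal.ofReal (S - L)) := by
    ext j
    by_cases hj : j = i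
    · subst hj; simp
    · simp [hj]
  rw [Real.volume_Icc_pi, h, Finset.prod_update_of_mem (Finset.mem_univ i)]
  simp [Finset.card_sdiff]

lemma volume_Icc_const (s b : ℝ) :
    volume (Set.Icc (fun _ : Fin n => -s) (fun _ => b)) = ENNReal.ofReal (b + s) ^ n := by
  simp [Real.volume_Icc_pi]

namespace IsLogIntegrableDensity

variable {p : (Fin n → ℝ) → ℝ} (hp : IsLogIntegrableDensity p)
include hp

/-- Scales in `[-s, M]ⁿ` have fibres of mass at least one half, and this cube has side at least `s /
2`, so the normaliser is at least `(s / 2) ^ n / 2`. -/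
lemma inv_normaliser_le {r : (Fin n → ℝ) → ℝ} {lam a s b M : ℝ}
    (hψ : IsMixingDensityOn r lam (paramBox n a s b) (restrictedWeight p (paramBox n a s b)))
    (hM : ∀ σ : Fin n → ℝ, (∀ i, σ i ≤ M) → 2⁻¹ ≤ ∫⁻ μ, cutWeight p a σ μ)
    (hs : 0 < s) (hMs : -(s / 2) ≤ M) (hMb : M ≤ b) :
    (∫⁻ θ in paramBox n a s b, weightENN p θ)⁻¹ ≤ ENNReal.ofReal (2 * (2 / s) ^ n) := by
  set N := ∫⁻ θ in paramBox n a s b, weightENN p θ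
  have h1 : N⁻¹ * (2⁻¹ * ENNReal.ofReal (s / 2) ^ n) ≤ 1 := by
    calc N⁻¹ * (2⁻¹ * ENNReal.ofReal (s / 2) ^ n)
        ≤ N⁻¹ * (2⁻¹ * volume (Set.Icc (fun _ : Fin n => -s) (fun _ => M))) := by
          rw [volume_Icc_const]
          gcongr
          linarith
      _ = ∫⁻ _ in Set.Icc (fun _ : Fin n => -s) (fun _ => M), N⁻¹ * 2⁻¹ := by
          rw [setLIntegral_const, mul_assoc]
      _ ≤ ∫⁻ σ in Set.Icc (fun _ : Fin n => -s) (fun _ => M),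
            scaleMarginal (restrictedWeight p (paramBox n a s b)) σ := by
          refine setLIntegral_mono' measurableSet_Icc fun σ hσ => ?_
          have hσ' : σ ∈ Set.Icc (fun _ : Fin n => -s) (fun _ => b) :=
            ⟨hσ.1, hσ.2.trans fun _ => hMb⟩
          rw [hp.scaleMarginal_restrictedWeight hψ.volume_ne_zero, Set.indicator_of_mem hσ']
          gcongr
          exact hM σ hσ.2
      _ ≤ 1 := (setLIntegral_le_lintegral _ _).trans_eq hψ.lintegral_scaleMarginal
  have h2 : ENNReal.ofReal (2 * (2 / s) ^ n) * (2⁻¹ * ENNReal.ofReal (s / 2) ^ n) = 1 := by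
    rw [← ENNReal.ofReal_pow (by positivity), show (2⁻¹ : ENNReal) = ENNReal.ofReal 2⁻¹ by
      rw [ENNReal.ofReal_inv_of_pos two_pos, ENNReal.ofReal_ofNat], ← ENNReal.ofReal_mul
      (by norm_num), ← ENNReal.ofReal_mul (by positivity), ← ENNReal.ofReal_one]
    congr 1
    rw [mul_mul_mul_comm, ← mul_pow]
    field_simp
    simp
  calc N⁻¹ = N⁻¹ * (ENNReal.ofReal (2 * (2 / s) ^ n) * (2⁻¹ * ENNReal.ofReal (s / 2) ^ n)) := by
        rw [h2, mul_one]
    _ = ENNReal.ofReal (2 * (2 / s) ^ n) * (N⁻¹ * (2⁻¹ * ENNReal.ofReal (s / 2) ^ n)) := by ring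
    _ ≤ _ := mul_le_of_le_one_right zero_le h1

/-- For `L < σ i < S` the fibre mass is at most one over a slab of width `S - L`; for `σ i ≥ S` it
is at most `ε` over the whole box of scales. -/
lemma mixingLaw_wide_coord_le {r : (Fin n → ℝ) → ℝ} {lam a s b C L S ε : ℝ}
    (hψ : IsMixingDensityOn r lam (paramBox n a s b) (restrictedWeight p (paramBox n a s b)))
    (hS : ∀ (σ : Fin n → ℝ) (i : Fin n), S ≤ σ i →
      ∫⁻ μ, weightENN p (μ, σ) ≤ ENNReal.ofReal ε)
    (hε : 0 ≤ ε) (hLS : L ≤ S) (hC : b + s ≤ C * s) (hCs : 0 ≤ C * s) (i : Fin n) :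
    mixingLaw (restrictedWeight p (paramBox n a s b)) {θ | L < θ.2 i} ≤
      (∫⁻ θ in paramBox n a s b, weightENN p θ)⁻¹ *
        ENNReal.ofReal ((S - L) * (C * s) ^ (n - 1) + ε * (C * s) ^ n) := by
  set N := ∫⁻ θ in paramBox n a s b, weightENN p θ
  set I := Set.Icc (fun _ : Fin n => -s) (fun _ => b)
  set J := Set.Icc (Function.update (fun _ : Fin n => -s) i L) (Function.update (fun _ => b) i S)
  have hA : MeasurableSet {σ : Fin n → ℝ | L < σ i} :=
    measurableSet_lt measurable_const (measurable_pi_apply i)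
  calc mixingLaw (restrictedWeight p (paramBox n a s b)) {θ | L < θ.2 i}
      = ∫⁻ σ in {σ : Fin n → ℝ | L < σ i},
          scaleMarginal (restrictedWeight p (paramBox n a s b)) σ := hψ.mixingLaw_snd hA
    _ ≤ ∫⁻ σ in {σ : Fin n → ℝ | L < σ i},
          N⁻¹ * (J.indicator 1 σ + I.indicator (fun _ => ENNReal.ofReal ε) σ) := by
        refine setLIntegral_mono' hA fun σ hσ => ?_
        rw [hp.scaleMarginal_restrictedWeight hψ.volume_ne_zero]
        by_cases hI : σ ∈ I
        · rw [Set.indicator_of_mem hI, Set.indicator_of_mem hI]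
          gcongr
          rcases le_or_gt S (σ i) with h | h
          · have hle : ∫⁻ μ, cutWeight p a σ μ ≤ ∫⁻ μ, weightENN p (μ, σ) :=
              lintegral_mono fun _ => Set.indicator_le_self _ _ _
            exact (hle.trans (hS σ i h)).trans le_add_self
          · have hJ : σ ∈ J := by
              refine ⟨?_, ?_⟩
              · rw [update_le_iff]
                exact ⟨le_of_lt hσ, fun j _ => hI.1 j⟩
              · rw [le_update_iff]
                exact ⟨h.le, fun j _ => hI.2 j⟩
            rw [Set.indicator_of_mem hJ]
            exact (hp.lintegral_cutWeight_le_one a σ).trans le_self_add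
        · rw [Set.indicator_of_notMem hI]
          exact zero_le
    _ ≤ ∫⁻ σ, N⁻¹ * (J.indicator 1 σ + I.indicator (fun _ => ENNReal.ofReal ε) σ) :=
        setLIntegral_le_lintegral _ _
    _ = N⁻¹ * (volume J + ENNReal.ofReal ε * volume I) := by
        have hJm : Measurable (J.indicator (1 : (Fin n → ℝ) → ENNReal)) :=
          measurable_one.indicator measurableSet_Icc
        have hIm : Measurable (I.indicator fun _ => ENNReal.ofReal ε) :=
          measurable_const.indicator measurableSet_Icc
        have hJI : Measurable fun σ => J.indicator (1 : (Fin n → ℝ) → ENNReal) σ +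
          I.indicator (fun _ => ENNReal.ofReal ε) σ := hJm.add hIm
        rw [lintegral_const_mul _ hJI, lintegral_add_left hJm,
          lintegral_indicator_one measurableSet_Icc, lintegral_indicator_const measurableSet_Icc]
    _ ≤ _ := by
        have h1 : 0 ≤ (S - L) * (C * s) ^ (n - 1) :=
          mul_nonneg (sub_nonneg.2 hLS) (pow_nonneg hCs _)
        have h2 : 0 ≤ ε * (C * s) ^ n := mul_nonneg hε (pow_nonneg hCs _)
        gcongr
        rw [volume_slab, volume_Icc_const, ENNReal.ofReal_add h1 h2,
          ENNReal.ofReal_mul (sub_nonneg.2 hLS), ENNReal.ofReal_mul hε,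
          ENNReal.ofReal_pow hCs, ENNReal.ofReal_pow hCs]
        gcongr

lemma mixingLaw_wide_le {r : (Fin n → ℝ) → ℝ} {lam a s b C L S M ε : ℝ}
    (hψ : IsMixingDensityOn r lam (paramBox n a s b) (restrictedWeight p (paramBox n a s b)))
    (hS : ∀ (σ : Fin n → ℝ) (i : Fin n), S ≤ σ i →
      ∫⁻ μ, weightENN p (μ, σ) ≤ ENNReal.ofReal ε)
    (hM : ∀ σ : Fin n → ℝ, (∀ i, σ i ≤ M) → 2⁻¹ ≤ ∫⁻ μ, cutWeight p a σ μ)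
    (hε : 0 ≤ ε) (hs : 0 < s) (hMs : -(s / 2) ≤ M) (hMb : M ≤ b) (hLS : L ≤ S) (hC0 : 0 ≤ C)
    (hC : b + s ≤ C * s) :
    mixingLaw (restrictedWeight p (paramBox n a s b)) {θ | ∃ i, L < θ.2 i} ≤
      ENNReal.ofReal (n * (2 * 2 ^ n * (C ^ (n - 1) * ((S - L) / s) + ε * C ^ n))) := by
  have hunion : {θ : Param n | ∃ i, L < θ.2 i} = ⋃ i, {θ | L < θ.2 i} := by
    ext θ; simp
  rw [hunion]
  refine (measure_iUnion_fintype_le _ _).trans ?_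
  calc ∑ i, mixingLaw (restrictedWeight p (paramBox n a s b)) {θ | L < θ.2 i}
      ≤ ∑ _i : Fin n, ENNReal.ofReal (2 * 2 ^ n * (C ^ (n - 1) * ((S - L) / s) + ε * C ^ n)) := by
        refine Finset.sum_le_sum fun i _ => ?_
        refine (hp.mixingLaw_wide_coord_le hψ hS hε hLS hC (by positivity) i).trans ?_
        refine (mul_le_mul_left (hp.inv_normaliser_le hψ hM hs hMs hMb) _).trans ?_
        rw [← ENNReal.ofReal_mul (by positivity)]
        refine le_of_eq (congrArg _ ?_)
        -- The coordinate `i` witnesses `n ≥ 1`, so the truncated `n - 1` is a true predecessor and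
        -- `s ^ n` cancels to leave `(S - L) / s`.
        obtain ⟨m, rfl⟩ : ∃ m, n = m + 1 := ⟨n - 1, by have := i.pos; omega⟩
        simp only [Nat.add_sub_cancel, mul_pow, div_pow, pow_succ]
        field_simp
    _ = _ := by
        rw [Finset.sum_const, Finset.card_univ, Fintype.card_fin, nsmul_eq_mul,
          ENNReal.ofReal_mul n.cast_nonneg, ENNReal.ofReal_natCast]

lemma eventually_half_le_lintegral_cutWeight {a : ℕ → ℝ} (ha : Tendsto a atTop atTop) :
    ∃ M : ℝ, M ≤ 0 ∧ ∀ᶠ k in atTop, ∀ σ : Fin n → ℝ, (∀ i, σ i ≤ M) →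
      2⁻¹ ≤ ∫⁻ μ, cutWeight p (a k) σ μ := by
  have hq : (0 : ENNReal) < 2⁻¹ / 2 := ENNReal.half_pos (by simp)
  obtain ⟨S, hS⟩ := (ENNReal.tendsto_nhds_zero.1 hp.tendsto_deficit _ hq).exists_forall_of_atBot
  -- One real threshold below every coordinate of the vector `S`.
  refine ⟨-∑ i, |S i|, neg_nonpos.2 (Finset.sum_nonneg fun i _ => abs_nonneg _), ?_⟩
  filter_upwards [ha.eventually (ENNReal.tendsto_nhds_zero.1 hp.tendsto_lintegral_compl_cube _ hq)]
    with k hk σ hσ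
  have hσS : σ ≤ S := fun i => by
    have h1 := Finset.single_le_sum (f := fun i => |S i|) (fun i _ => abs_nonneg _)
      (Finset.mem_univ i)
    have h2 := neg_abs_le (S i)
    have h3 := hσ i
    linarith
  have h := hp.one_le_lintegral_weightENN_add σ (a k)
  rw [← lintegral_indicator (measurableSet_cube _)] at h
  exact ENNReal.half_le_of_one_le_add h ((add_le_add (hS σ hσS) hk).trans_eq (ENNReal.add_halves _))

/-- On exhausting boxes the scales fall below any threshold that is negligible against the depth
of the box. -/
theorem tendsto_mixingLaw_wide {r : (Fin n → ℝ) → ℝ} {lam : ℝ} {a s b L : ℕ → ℝ}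
    (ha : Tendsto a atTop atTop) (hs : Tendsto s atTop atTop) (hb : Tendsto b atTop atTop)
    (hbs : b =O[atTop] s) (hL0 : ∀ k, L k ≤ 0) (hL : Tendsto (fun k => L k / s k) atTop (𝓝 0))
    (hψ : ∀ k, IsMixingDensityOn r lam (paramBox n (a k) (s k) (b k))
      (restrictedWeight p (paramBox n (a k) (s k) (b k)))) :
    Tendsto (fun k => mixingLaw (restrictedWeight p (paramBox n (a k) (s k) (b k)))
      {θ | ∃ i, L k < θ.2 i}) atTop (𝓝 0) := by
  obtain ⟨c, hc0, hc⟩ := hbs.exists_nonneg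
  obtain ⟨M, hM0, hM⟩ := hp.eventually_half_le_lintegral_cutWeight ha
  rw [ENNReal.tendsto_nhds_zero]
  intro ε hε
  obtain ⟨e, he, heε⟩ : ∃ e : ℝ, 0 < e ∧ ENNReal.ofReal e ≤ ε := by
    obtain ⟨e, h1, h2⟩ := ENNReal.lt_iff_exists_nnreal_btwn.1 hε
    exact ⟨e, by exact_mod_cast h1, by simpa using h2.le⟩
  -- `b ≤ c * s` gives `b + s ≤ C * s`. The choice of `ε'` keeps the very wide part below `e / 2`,
  -- the `+ 1` keeping the denominator positive; the slab part is below `e / 2` eventually because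
  -- `(S - L k) / s k → 0`.
  set C := c + 1 with hC
  set ε' := e / 2 / (n * (2 * 2 ^ n) * C ^ n + 1) with hε'
  have hC0 : 0 ≤ C := by positivity
  have hε'0 : 0 < ε' := by positivity
  obtain ⟨S', hS'⟩ := hp.exists_lintegral_weightENN_le (ε := ENNReal.ofReal ε')
    (by simpa using hε'0)
  set S := max S' 0
  have hlim : Tendsto (fun k => n * (2 * 2 ^ n * (C ^ (n - 1) * ((S - L k) / s k)))) atTop
      (𝓝 0) := by
    have h1 : Tendsto (fun k => (S - L k) / s k) atTop (𝓝 0) := by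
      simp_rw [sub_div]
      simpa using (tendsto_const_nhds.div_atTop hs).sub hL
    simpa using ((h1.const_mul (C ^ (n - 1))).const_mul (2 * 2 ^ n)).const_mul (n : ℝ)
  filter_upwards [hM, hs.eventually_gt_atTop 0, hs.eventually_ge_atTop (-(2 * M)),
    hb.eventually_ge_atTop M, hc.bound, hlim.eventually_le_const (half_pos he)]
    with k hMk hsk hsM hbM hbk hlk
  refine (hp.mixingLaw_wide_le (hψ k) (C := C) (S := S) (ε := ε')
    (fun σ i h => hS' σ i ((le_max_left _ _).trans h)) hMk hε'0.le hsk (by linarith) hbM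
    ((hL0 k).trans (le_max_right _ _)) hC0 ?_).trans (le_trans (ENNReal.ofReal_le_ofReal ?_) heε)
  · rw [Real.norm_eq_abs, Real.norm_of_nonneg hsk.le] at hbk
    have := le_abs_self (b k)
    rw [hC]
    linarith
  · have h1 : (n * (2 * 2 ^ n) * C ^ n + 1) * ε' = e / 2 := by rw [hε']; field_simp
    nlinarith

end IsLogIntegrableDensity
end Narrow

/-! ### The mixing densities on exhausting boxes are sampling -/

section Sampling
variable {n : ℕ}

lemma mixingLaw_congr {ψ φ : Param n → ℝ} (h : ψ =ᵐ[volume] φ) : mixingLaw ψ = mixingLaw φ :=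
  withDensity_congr_ae (h.mono fun θ hθ => by dsimp only; rw [hθ])

lemma mixture_congr {ψ φ : Param n → ℝ} (h : ψ =ᵐ[volume] φ) : mixture ψ = mixture φ := by
  ext x
  exact integral_congr_ae (h.mono fun θ hθ => by dsimp only; rw [hθ])

lemma integral_snd_congr {ψ φ : Param n → ℝ} (h : ψ =ᵐ[volume] φ) :
    ∀ᵐ μ : Fin n → ℝ, ∫ σ, ψ (μ, σ) = ∫ σ, φ (μ, σ) := by
  rw [Measure.volume_eq_prod] at h
  filter_upwards [Measure.ae_ae_of_ae_prod h] with μ hμ using integral_congr_ae hμ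

namespace IsMixingDensityOn

variable {r : (Fin n → ℝ) → ℝ} {lam : ℝ} {K : Set (Param n)} {ψ : Param n → ℝ}
  (hψ : IsMixingDensityOn r lam K ψ)
include hψ

lemma mixingLaw_compl (hK : MeasurableSet K) : mixingLaw ψ Kᶜ = 0 := by
  rw [mixingLaw, withDensity_apply _ hK.compl]
  refine (setLIntegral_congr_fun hK.compl fun θ hθ => ?_).trans lintegral_zero
  simp [hψ.zero_off θ hθ]

lemma mixingLaw_fst_le {A : Set (Fin n → ℝ)} (hA : MeasurableSet A) (p : (Fin n → ℝ) → ℝ)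
    (hp : Measurable p) :
    mixingLaw ψ {θ | θ.1 ∈ A} ≤ (∫⁻ μ in A, ENNReal.ofReal (p μ)) +
      ∫⁻ μ, ‖(∫ σ, ψ (μ, σ)) - p μ‖ₑ := by
  have hm : MeasurableSet {θ : Param n | θ.1 ∈ A} := measurable_fst hA
  have e : mixingLaw ψ {θ | θ.1 ∈ A} = ∫⁻ μ in A, ENNReal.ofReal (∫ σ, ψ (μ, σ)) := by
    rw [setLIntegral_congr_fun_ae hA (hψ.integral_snd_eq.mono fun μ hμ _ => hμ),
      mixingLaw, withDensity_apply _ hm, ← lintegral_indicator hm, ← lintegral_indicator hA,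
      Measure.volume_eq_prod, lintegral_prod _ (hψ.measurable_ofReal.indicator hm).aemeasurable]
    refine lintegral_congr fun μ => ?_
    by_cases hμ : μ ∈ A <;> simp [hμ, Set.indicator]
  rw [e]
  refine le_trans ?_ (add_le_add le_rfl (setLIntegral_le_lintegral A _))
  rw [← lintegral_add_left hp.ennreal_ofReal]
  refine lintegral_mono fun μ => ?_
  dsimp only
  rw [← ofReal_norm, Real.norm_eq_abs]
  refine le_trans (ENNReal.ofReal_le_ofReal ?_) ENNReal.ofReal_add_le
  linarith [le_abs_self ((∫ σ, ψ (μ, σ)) - p μ)]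

end IsMixingDensityOn

/-- The strong law of large numbers for the finite mixtures. -/
theorem IsMixingDensityOn.tendsto_finiteMixture {r : (Fin n → ℝ) → ℝ} {lam a s b : ℝ}
    {ψ : Param n → ℝ} (hψ : IsMixingDensityOn r lam (paramBox n a s b) ψ)
    {Ω : Type*} [MeasurableSpace Ω] {P : Measure Ω} [IsProbabilityMeasure P]
    {ϑ : ℕ → Ω → Param n} (hϑ : ∀ t, Measurable (ϑ t)) (hind : iIndepFun ϑ P)
    (hlaw : ∀ t, P.map (ϑ t) = mixingLaw ψ) (x : Fin n → ℝ) :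
    ∀ᵐ ω ∂P, Tendsto (fun T => finiteMixture (fun t => ϑ t ω) T x) atTop (𝓝 (mixture ψ x)) := by
  have hc := measurable_component_left x
  have hint : Integrable (fun θ => component θ x) (mixingLaw ψ) := by
    rw [mixingLaw, integrable_withDensity_iff_integrable_smul' hψ.measurable_ofReal
      (ae_of_all _ fun _ => ENNReal.ofReal_lt_top)]
    refine (hψ.integrable_component_mul x).congr (ae_of_all _ fun θ => ?_)
    simp only [smul_eq_mul, ENNReal.toReal_ofReal (hψ.nonneg θ)]
    ring
  have hval : ∫ θ, component θ x ∂mixingLaw ψ = mixture ψ x := by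
    rw [mixingLaw, integral_withDensity_eq_integral_toReal_smul hψ.measurable_ofReal
      (ae_of_all _ fun _ => ENNReal.ofReal_lt_top)]
    refine integral_congr_ae (ae_of_all _ fun θ => ?_)
    simp only [smul_eq_mul, ENNReal.toReal_ofReal (hψ.nonneg θ)]
    ring
  have hid : ∀ i, IdentDistrib (ϑ i) (ϑ 0) P P := fun i =>
    ⟨(hϑ i).aemeasurable, (hϑ 0).aemeasurable, by rw [hlaw, hlaw]⟩
  have h := strong_law_ae_real (μ := P) (fun t ω => component (ϑ t ω) x)
    (by
      rw [← hlaw 0] at hint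
      exact hint.comp_measurable (hϑ 0))
    (fun i j hij => (hind.indepFun hij).comp hc hc)
    (fun i => (hid i).comp hc)
  have hE : ∫ ω, component (ϑ 0 ω) x ∂P = mixture ψ x := by
    rw [← hval, ← hlaw 0, integral_map (hϑ 0).aemeasurable hc.aestronglyMeasurable]
  rw [hE] at h
  filter_upwards [h] with ω hω
  refine hω.congr fun T => ?_
  rw [finiteMixture, one_div, div_eq_inv_mul]

/-! ### Overlap of two components. -/

/-- The normalising constant contributes at most `n * s` to the log-density, so being above `log ε`
bounds each quadratic term by `n * s - log ε`. -/
lemma sq_sub_mean_le {θ : Param n} {x : Fin n → ℝ} {ε s : ℝ} (hε : 0 < ε)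
    (hx : ε ≤ component θ x) (hθ : ∀ i, -s ≤ θ.2 i) (i : Fin n) :
    (x i - θ.1 i) ^ 2 ≤ 2 * Real.exp (2 * θ.2 i) * (n * s - Real.log ε) := by
  have h1 := Real.log_le_log hε hx
  have hpi : 0 ≤ Real.log (2 * Real.pi) := Real.log_nonneg (by linarith [Real.pi_gt_three])
  rw [log_component] at h1
  have h2 : ∑ j, (-(1 / 2 * Real.log (2 * Real.pi)) - θ.2 j -
      (x j - θ.1 j) ^ 2 * Real.exp (-(2 * θ.2 j)) / 2) ≤
      ∑ j, (s - if j = i then (x j - θ.1 j) ^ 2 * Real.exp (-(2 * θ.2 j)) / 2 else 0) := by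
    refine Finset.sum_le_sum fun j _ => ?_
    have hj := hθ j
    have hsq : 0 ≤ (x j - θ.1 j) ^ 2 * Real.exp (-(2 * θ.2 j)) / 2 := by positivity
    split_ifs <;> linarith
  have h2' : ∑ j, (s - if j = i then (x j - θ.1 j) ^ 2 * Real.exp (-(2 * θ.2 j)) / 2 else 0) =
      n * s - (x i - θ.1 i) ^ 2 * Real.exp (-(2 * θ.2 i)) / 2 := by
    rw [Finset.sum_sub_distrib, Finset.sum_ite_eq' Finset.univ i]
    simp
  rw [h2'] at h2
  have h3 : Real.exp (2 * θ.2 i) * Real.exp (-(2 * θ.2 i)) = 1 := by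
    rw [← Real.exp_add]; simp
  have h4 := mul_le_mul_of_nonneg_left (h1.trans h2) (Real.exp_pos (2 * θ.2 i)).le
  calc (x i - θ.1 i) ^ 2
      = (x i - θ.1 i) ^ 2 * (Real.exp (2 * θ.2 i) * Real.exp (-(2 * θ.2 i))) := by
        rw [h3, mul_one]
    _ ≤ _ := by linarith

lemma dist_mean_le {θ θ' : Param n} {x : Fin n → ℝ} {ε s L : ℝ} (hε : 0 < ε)
    (hx : ε ≤ component θ x) (hx' : ε ≤ component θ' x) (hθ : ∀ i, -s ≤ θ.2 i ∧ θ.2 i ≤ L)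
    (hθ' : ∀ i, -s ≤ θ'.2 i ∧ θ'.2 i ≤ L) :
    dist θ'.1 θ.1 ≤ 2 * √(2 * Real.exp (2 * L) * |n * s - Real.log ε|) := by
  have key : ∀ {φ : Param n}, ε ≤ component φ x → (∀ i, -s ≤ φ.2 i ∧ φ.2 i ≤ L) → ∀ i,
      |x i - φ.1 i| ≤ √(2 * Real.exp (2 * L) * |n * s - Real.log ε|) := by
    intro φ hφ hb i
    refine Real.abs_le_sqrt ((sq_sub_mean_le hε hφ (fun i => (hb i).1) i).trans ?_)
    have h1 : Real.exp (2 * φ.2 i) ≤ Real.exp (2 * L) :=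
      Real.exp_le_exp.2 (by linarith [(hb i).2])
    calc _ ≤ 2 * Real.exp (2 * φ.2 i) * |n * s - Real.log ε| :=
          mul_le_mul_of_nonneg_left (le_abs_self _) (by positivity)
      _ ≤ _ := by gcongr
  refine (dist_pi_le_iff (by positivity)).2 fun i => ?_
  rw [Real.dist_eq, show θ'.1 i - θ.1 i = (x i - θ.1 i) - (x i - θ'.1 i) by ring, two_mul]
  exact (norm_sub_le (x i - θ.1 i) (x i - θ'.1 i)).trans (add_le_add (key hx hθ i) (key hx' hθ' i))

/-- An overlap requires a draw outside the box (a null event), a wide draw, or means within the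
radius of `dist_mean_le`. For the last, fix the first mean: the second falls in a small ball with
probability at most its `p`-mass plus the `L¹` error of the mean marginal. Monotonicity of the
measure makes measurability of the overlap set unnecessary. -/
lemma prod_mixingLaw_overlap_le {r : (Fin n → ℝ) → ℝ} {lam a s b L ε : ℝ} {ψ : Param n → ℝ}
    (hψ : IsMixingDensityOn r lam (paramBox n a s b) ψ) (hε : 0 < ε)
    {p : (Fin n → ℝ) → ℝ} (hp : Measurable p) {κ : ENNReal}
    (hκ : ∀ μ : Fin n → ℝ, ∫⁻ y in Metric.closedBall μ
      (2 * √(2 * Real.exp (2 * L) * |n * s - Real.log ε|)), ENNReal.ofReal (p y) ≤ κ) :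
    ((mixingLaw ψ).prod (mixingLaw ψ))
      {w | ¬ ∀ x, ε < component w.1 x → component w.2 x < ε} ≤
      2 * mixingLaw ψ {θ | ∃ i, L < θ.2 i} + (κ + ∫⁻ μ, ‖(∫ σ, ψ (μ, σ)) - p μ‖ₑ) := by
  have := hψ.isProbabilityMeasure_mixingLaw
  set η := 2 * √(2 * Real.exp (2 * L) * |n * s - Real.log ε|)
  set B : Set (Param n) := (paramBox n a s b)ᶜ ∪ {θ | ∃ i, L < θ.2 i}
  set D : Set (Param n × Param n) := {w | dist w.2.1 w.1.1 ≤ η}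
  have hsub : {w : Param n × Param n | ¬ ∀ x, ε < component w.1 x → component w.2 x < ε} ⊆
      (B ×ˢ Set.univ ∪ Set.univ ×ˢ B) ∪ D := by
    intro w hw
    simp only [Set.mem_ofPred_eq] at hw
    push Not at hw
    obtain ⟨x, hx1, hx2⟩ := hw
    by_cases h1 : w.1 ∈ B
    · exact Or.inl (Or.inl ⟨h1, trivial⟩)
    by_cases h2 : w.2 ∈ B
    · exact Or.inl (Or.inr ⟨trivial, h2⟩)
    refine Or.inr ?_
    have hb : ∀ {φ : Param n}, φ ∉ B → ∀ i, -s ≤ φ.2 i ∧ φ.2 i ≤ L := by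
      intro φ hφ i
      refine ⟨?_, not_lt.1 fun h => hφ (Or.inr ⟨i, h⟩)⟩
      by_contra h
      exact hφ (Or.inl fun hm => h (hm i).2.1)
    exact dist_mean_le hε hx1.le hx2 (hb h1) (hb h2)
  have hB : mixingLaw ψ B ≤ mixingLaw ψ {θ | ∃ i, L < θ.2 i} :=
    (measure_union_le _ _).trans_eq (by
      rw [hψ.mixingLaw_compl (measurableSet_paramBox a s b), zero_add])
  have hDm : MeasurableSet D :=
    measurableSet_le ((measurable_fst.comp measurable_snd).dist
      (measurable_fst.comp measurable_fst)) measurable_const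
  have hD : ((mixingLaw ψ).prod (mixingLaw ψ)) D ≤ κ + ∫⁻ μ, ‖(∫ σ, ψ (μ, σ)) - p μ‖ₑ := by
    rw [Measure.prod_apply hDm]
    refine (lintegral_mono (g := fun _ => κ + ∫⁻ μ, ‖(∫ σ, ψ (μ, σ)) - p μ‖ₑ)
      fun θ => ?_).trans_eq (by simp)
    refine (hψ.mixingLaw_fst_le (A := Metric.closedBall θ.1 η) measurableSet_closedBall p hp).trans
      (add_le_add (hκ θ.1) le_rfl)
  refine (measure_mono hsub).trans ((measure_union_le _ _).trans (add_le_add ?_ hD))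
  refine (measure_union_le _ _).trans ?_
  rw [Measure.prod_prod, Measure.prod_prod, measure_univ, one_mul, mul_one, ← two_mul]
  gcongr

/-! ### Limits along exhausting boxes. -/

namespace IsLogIntegrableDensity

variable {p : (Fin n → ℝ) → ℝ} (hp : IsLogIntegrableDensity p)
include hp

/-- Absolute continuity of the integral: the ball volume `(2η) ^ n` does not depend on the centre
and tends to zero because `n > 0`. -/
lemma exists_lintegral_closedBall_le (hn : 0 < n) {κ : ENNReal} (hκ : κ ≠ 0) :
    ∃ δ : ℝ, 0 < δ ∧ ∀ η, 0 ≤ η → η ≤ δ → ∀ μ : Fin n → ℝ,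
      ∫⁻ y in Metric.closedBall μ η, ENNReal.ofReal (p y) ≤ κ := by
  obtain ⟨d, hd, h⟩ := exists_pos_setLIntegral_lt_of_measure_lt (μ := volume)
    (f := fun y => ENNReal.ofReal (p y)) (by simp [hp.lintegral_eq_one]) hκ
  have hlim : Tendsto (fun η : ℝ => ENNReal.ofReal ((2 * η) ^ n)) (𝓝 0) (𝓝 0) := by
    have h1 : Tendsto (fun η : ℝ => (2 * η) ^ n) (𝓝 0) (𝓝 ((2 * 0) ^ n)) :=
      ((continuous_const.mul continuous_id).pow n).tendsto 0
    rw [mul_zero, zero_pow hn.ne'] at h1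
    simpa using ENNReal.tendsto_ofReal h1
  obtain ⟨δ, hδ, hδd⟩ := Metric.eventually_nhds_iff.1 (hlim.eventually_lt_const hd)
  refine ⟨δ / 2, by positivity, fun η hη0 hη μ => (h _ ?_).le⟩
  rw [Real.volume_pi_closedBall _ hη0, Fintype.card_fin]
  exact hδd (by rw [Real.dist_eq, sub_zero, abs_of_nonneg hη0]; linarith)

variable {r : (Fin n → ℝ) → ℝ} {lam : ℝ} {a s b : ℕ → ℝ}
  (ha : Tendsto a atTop atTop) (hs : Tendsto s atTop atTop) (hb : Tendsto b atTop atTop)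
  (hbs : b =O[atTop] s)
  (hψ : ∀ k, IsMixingDensityOn r lam (paramBox n (a k) (s k) (b k))
    (restrictedWeight p (paramBox n (a k) (s k) (b k))))
include ha hs hb hbs hψ

lemma tendsto_mixingLaw_wide_const (M : ℝ) :
    Tendsto (fun k => mixingLaw (restrictedWeight p (paramBox n (a k) (s k) (b k)))
      {θ | ∃ i, M < θ.2 i}) atTop (𝓝 0) := by
  refine tendsto_of_tendsto_of_tendsto_of_le_of_le tendsto_const_nhds
    (hp.tendsto_mixingLaw_wide ha hs hb hbs (L := fun _ => min M 0) (fun _ => min_le_right _ _)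
      (tendsto_const_nhds.div_atTop hs) hψ) (fun _ => zero_le) fun k => measure_mono ?_
  rintro θ ⟨i, hi⟩
  exact ⟨i, (min_le_left _ _).trans_lt hi⟩

theorem limitNarrow :
    LimitNarrow fun k => restrictedWeight p (paramBox n (a k) (s k) (b k)) := by
  intro δ hδ
  refine tendsto_of_tendsto_of_tendsto_of_le_of_le tendsto_const_nhds
    (hp.tendsto_mixingLaw_wide_const ha hs hb hbs hψ (Real.log δ)) (fun _ => zero_le)
    fun k => measure_mono fun θ hθ => ?_
  simp only [Set.mem_ofPred_eq] at hθ ⊢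
  push Not at hθ
  obtain ⟨i, hi⟩ := hθ
  exact ⟨i, (Real.log_lt_iff_lt_exp hδ).2 hi⟩

/-- At narrow scales the deficit is small; the other scales have vanishing probability, and there
the deficit is at most one. -/
lemma tendsto_lintegral_scaleMarginal_mul_deficit :
    Tendsto (fun k => ∫⁻ σ, scaleMarginal (restrictedWeight p (paramBox n (a k) (s k) (b k))) σ *
      deficit p σ) atTop (𝓝 0) := by
  rw [ENNReal.tendsto_nhds_zero]
  intro ε hε
  have hε2 := ENNReal.half_pos hε.ne'
  obtain ⟨S, hS⟩ := (ENNReal.tendsto_nhds_zero.1 hp.tendsto_deficit _ hε2).exists_forall_of_atBot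
  set M := -∑ i, |S i|
  filter_upwards [ENNReal.tendsto_nhds_zero.1
    (hp.tendsto_mixingLaw_wide_const ha hs hb hbs hψ M) _ hε2] with k hk
  set ρ := scaleMarginal (restrictedWeight p (paramBox n (a k) (s k) (b k)))
  have hρ : Measurable ρ := (hψ k).measurable_scaleMarginal
  set A : Set (Fin n → ℝ) := {σ | ∃ i, M < σ i}
  have hA : MeasurableSet A := by
    have : A = ⋃ i, {σ | M < σ i} := by ext σ; simp [A]
    rw [this]
    exact MeasurableSet.iUnion fun i => measurableSet_lt measurable_const (measurable_pi_apply i)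
  have hpt : ∀ σ, ρ σ * deficit p σ ≤ ρ σ * (ε / 2) + A.indicator ρ σ := by
    intro σ
    by_cases hσ : σ ∈ A
    · rw [Set.indicator_of_mem hσ]
      exact (mul_le_of_le_one_right zero_le (hp.deficit_le_one σ)).trans le_add_self
    · refine le_trans ?_ le_self_add
      gcongr
      refine hS σ fun i => ?_
      have h1 : σ i ≤ M := not_lt.1 fun h => hσ ⟨i, h⟩
      have h2 := Finset.single_le_sum (f := fun i => |S i|) (fun i _ => abs_nonneg _)
        (Finset.mem_univ i)
      linarith [neg_abs_le (S i)]
  refine (lintegral_mono hpt).trans ?_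
  rw [lintegral_add_left (hρ.mul_const _), lintegral_mul_const _ hρ,
    (hψ k).lintegral_scaleMarginal, one_mul, lintegral_indicator hA,
    ← (hψ k).mixingLaw_snd hA]
  exact (add_le_add le_rfl hk).trans_eq (ENNReal.add_halves ε)

theorem limitMeansDistributedAs :
    LimitMeansDistributedAs p fun k => restrictedWeight p (paramBox n (a k) (s k) (b k)) := by
  have h := ENNReal.Tendsto.const_mul (a := 2)
    ((hp.tendsto_lintegral_scaleMarginal_mul_deficit ha hs hb hbs hψ).add
      (hp.tendsto_lintegral_compl_cube.comp ha)) (Or.inr ENNReal.ofNat_ne_top)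
  rw [add_zero, mul_zero] at h
  exact tendsto_of_tendsto_of_tendsto_of_le_of_le tendsto_const_nhds h (fun _ => zero_le)
    fun k => hp.lintegral_means_le (hψ k)

theorem limitUnbiased :
    LimitUnbiased p fun k => restrictedWeight p (paramBox n (a k) (s k) (b k)) := by
  have h := ENNReal.Tendsto.const_mul (a := 2)
    ((ENNReal.Tendsto.const_mul (a := 2)
      (hp.tendsto_lintegral_scaleMarginal_mul_deficit ha hs hb hbs hψ)
      (Or.inr ENNReal.ofNat_ne_top)).add
      (hp.tendsto_lintegral_compl_cube.comp ha)) (Or.inr ENNReal.ofNat_ne_top)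
  rw [mul_zero, add_zero, mul_zero] at h
  exact tendsto_of_tendsto_of_tendsto_of_le_of_le tendsto_const_nhds h (fun _ => zero_le)
    fun k => hp.lintegral_mixture_le (hψ k)

theorem limitNonOverlapping (hn : 0 < n) :
    LimitNonOverlapping fun k => restrictedWeight p (paramBox n (a k) (s k) (b k)) := by
  intro ε hε
  have hsqrt : Tendsto (fun k => √(s k)) atTop atTop := Real.tendsto_sqrt_atTop.comp hs
  -- The threshold `-√s` is negligible against the depth `s`, so draws lie below it, yet `exp
  -- (-2√s)` still beats the factor `n * s` in the overlap radius.
  have hwide := hp.tendsto_mixingLaw_wide ha hs hb hbs (L := fun k => -√(s k))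
    (fun k => neg_nonpos.2 (Real.sqrt_nonneg _)) (by
      have h1 : Tendsto (fun k => -(√(s k))⁻¹) atTop (𝓝 0) := by
        simpa using (tendsto_inv_atTop_zero.comp hsqrt).neg
      refine h1.congr fun k => ?_
      rw [neg_div, Real.sqrt_div_self', one_div]) hψ
  have hη : Tendsto (fun k => 2 * √(2 * Real.exp (2 * -√(s k)) * |n * s k - Real.log ε|)) atTop
      (𝓝 0) := by
    -- With `t = √s` the radius is `2 √(2 exp (-2t) |n t² - log ε|)`.
    have h1 : Tendsto (fun t : ℝ => t ^ 2 * Real.exp (-t)) atTop (𝓝 0) :=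
      Real.tendsto_pow_mul_exp_neg_atTop_nhds_zero 2
    have h2 : Tendsto (fun t : ℝ => 2 * (Real.exp (-t) *
        (n * (t ^ 2 * Real.exp (-t)) - Real.log ε * Real.exp (-t)))) atTop (𝓝 0) := by
      simpa using ((Real.tendsto_exp_neg_atTop_nhds_zero.mul ((h1.const_mul (n : ℝ)).sub
        (Real.tendsto_exp_neg_atTop_nhds_zero.const_mul (Real.log ε)))).const_mul 2)
    have h3 := (h2.comp hsqrt).abs.sqrt.const_mul 2
    simp only [abs_zero, Real.sqrt_zero, mul_zero] at h3
    refine h3.congr' ?_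
    filter_upwards [hs.eventually_ge_atTop 0] with k hk
    simp only [Function.comp_apply]
    have e : Real.exp (2 * -√(s k)) = Real.exp (-√(s k)) * Real.exp (-√(s k)) := by
      rw [← Real.exp_add]; ring_nf
    have hE : 0 < 2 * (Real.exp (-√(s k)) * Real.exp (-√(s k))) := by positivity
    rw [Real.sq_sqrt hk, e, ← abs_of_pos hE, ← abs_mul]
    congr 3
    ring
  have hmeans := hp.limitMeansDistributedAs ha hs hb hbs hψ
  rw [ENNReal.tendsto_nhds_zero]
  intro κ hκ
  have hκ2 := ENNReal.half_pos hκ.ne'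
  have hκ4 := ENNReal.half_pos hκ2.ne'
  obtain ⟨δ, hδ, hball⟩ := hp.exists_lintegral_closedBall_le hn hκ4.ne'
  have hwide2 := ENNReal.Tendsto.const_mul (a := 2) hwide (Or.inr ENNReal.ofNat_ne_top)
  rw [mul_zero] at hwide2
  filter_upwards [ENNReal.tendsto_nhds_zero.1 hwide2 _ hκ2,
    ENNReal.tendsto_nhds_zero.1 hmeans _ hκ4, hη.eventually_le_const hδ] with k h1 h2 h3
  refine (prod_mixingLaw_overlap_le (hψ k) hε hp.measurable
    (hball _ (by positivity) h3)).trans ?_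
  calc _ ≤ κ / 2 + (κ / 2 / 2 + κ / 2 / 2) := add_le_add h1 (add_le_add le_rfl h2)
    _ = κ := by rw [ENNReal.add_halves, ENNReal.add_halves]

end IsLogIntegrableDensity
end Sampling

end

theorem mainTheorem3 (n : ℕ) (hn : 0 < n)
    (p : (Fin n → ℝ) → ℝ) (hp_meas : Measurable p) (hp_nonneg : ∀ x, 0 ≤ p x)
    (hp_pos : ∀ᵐ x, 0 < p x) (hp_int : Integrable p) (hp_one : ∫ x, p x = 1)
    (hp_log : ∀ θ : Param n, Integrable (fun x => component θ x * Real.log (p x)))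
    (Z : ℝ) (hZ : 0 < Z) (pstar : (Fin n → ℝ) → ℝ) (hpstar : ∀ x, pstar x = Z * p x) :
    -- the exponent of the closed-form optimum reduces to the negative cross-entropy
    (∀ θ : Param n, potential pstar 1 θ =
      expect θ (fun x => Real.log (p x)) +
        ((n : ℝ) / 2 * Real.log (4 * Real.pi * Real.exp 1) + Real.log Z)) ∧
    -- this density is improper
    (∫⁻ θ : Param n, ENNReal.ofReal (negCEWeight p θ) = ⊤) ∧
    -- on every bounded region it is, once normalised, the unique maximiser of the objective
    (∀ K : Set (Param n), MeasurableSet K → Bornology.IsBounded K → volume K ≠ 0 →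
      IsOptimalOn pstar 1 K (restrictedWeight p K) ∧
      ∀ ψ, IsOptimalOn pstar 1 K ψ → ψ =ᵐ[volume] restrictedWeight p K) ∧
    -- given a narrow scale, the mean is distributed according to `p`
    Tendsto (fun σ : Fin n → ℝ =>
        ∫⁻ μ, ‖negCEWeight p (μ, σ) / (∫ μ', negCEWeight p (μ', σ)) - p μ‖ₑ) atBot (𝓝 0) ∧
    -- the optimal mixing densities on boxes exhausting the parameter space are sampling
    (∀ a s b : ℕ → ℝ, Tendsto a atTop atTop → Tendsto s atTop atTop → Tendsto b atTop atTop →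
      b =O[atTop] s →
      ∀ ψ : ℕ → Param n → ℝ,
        (∀ k, IsOptimalOn pstar 1 (paramBox n (a k) (s k) (b k)) (ψ k)) →
        LimitNarrow ψ ∧ LimitNonOverlapping ψ ∧ LimitMeansDistributedAs p ψ ∧
        LimitUnbiased p ψ ∧
        ∀ (k : ℕ) (Ω : Type*) [MeasurableSpace Ω] (P : Measure Ω) [IsProbabilityMeasure P]
          (ϑ : ℕ → Ω → Param n), (∀ t, Measurable (ϑ t)) → iIndepFun ϑ P →
          (∀ t, P.map (ϑ t) = mixingLaw (ψ k)) →
          ∀ x, ∀ᵐ ω ∂P, Tendsto (fun T => finiteMixture (fun t => ϑ t ω) T x) atTop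
            (𝓝 (mixture (ψ k) x))) := by
  have hp : IsLogIntegrableDensity p :=
    ⟨hp_meas, hp_nonneg, hp_pos, hp_int, hp_one, hp_log⟩
  have hpot := potential_eq hp_pos hp_log hZ hpstar
  refine ⟨hpot, hp.lintegral_weightENN_eq_top hn,
    fun K hKm hK hvol => hp.isOptimalOn_restrictedWeight hpot hKm hK hvol,
    hp.tendsto_conditional, fun a s b ha hs hb hbs ψ hψ => ?_⟩
  -- By uniqueness each `ψ k` agrees almost everywhere with the normalised weight. Mixing laws,
  -- mixtures and almost every value of the mean marginal depend only on that class, so the limits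
  -- transfer.
  have hbox := fun k => hp.isOptimalOn_restrictedWeight hpot
    (measurableSet_paramBox (a k) (s k) (b k)) (isBounded_paramBox (a k) (s k) (b k))
    (hψ k).1.volume_ne_zero
  have hR := fun k => (hbox k).1.1
  have hae := fun k => (hbox k).2 (ψ k) (hψ k)
  have hlaw := fun k => mixingLaw_congr (hae k)
  have hmix := fun k => mixture_congr (hae k)
  refine ⟨fun δ hδ => ?_, fun ε hε => ?_, ?_, ?_, fun k Ω _ P _ ϑ hϑ hind hϑlaw x =>
    (hψ k).1.tendsto_finiteMixture hϑ hind hϑlaw x⟩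
  · simp_rw [hlaw]
    exact hp.limitNarrow ha hs hb hbs hR δ hδ
  · simp_rw [hlaw]
    exact hp.limitNonOverlapping ha hs hb hbs hR hn ε hε
  · refine (hp.limitMeansDistributedAs ha hs hb hbs hR).congr fun k => lintegral_congr_ae ?_
    filter_upwards [integral_snd_congr (hae k)] with μ hμ
    rw [hμ]
  · unfold LimitUnbiased
    simp_rw [hmix]
    exact hp.limitUnbiased ha hs hb hbs hR
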